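/- A \emph{PC prograph} is a finite connected directed plane graph without directed cycles whose vertices are coproducts (one input; a left and a right output) and products (a left and a right input; one output), drawn with the flow going upwards, in which exactly one coproduct has its input unconnected (the input of the prograph) and exactly one product has its output unconnected (the output of the prograph), both on the exterior face. Joining the output to the input by a virtual edge through the exterior gives a map on the sphere. Its dual, in which each edge is oriented from the left to the right of the prograph edge that it crosses and the dual of the virtual edge is the root, is a \emph{rooted oriented triangulation of the sphere}: a triangulation, with multiple edges allowed, oriented without directed cycles, with exactly one source and exactly one sink, and with a root edge from the source to the sink. This duality is a bijection between PC prographs and rooted oriented triangulations of the sphere, up to isomorphism. The type of a (non-virtual) edge of a PC prograph is given by the ports that it joins: from a left output of a coproduct, types I, II, III; from a right output of a coproduct, types IV, V, VI; from the output of a product, types VII, VIII, IX; in each triple the edge goes respectively to the input of a coproduct, the left input of a product, the right input of a product. The four \emph{rotation rules} replace two adjacent operators by two others with the same external connections, in the same left-to-right order: \begin{itemize} \item IV $\to$ I: a coproduct on the right output of a coproduct is moved to its left output; \item VIII $\to$ IX: a product on the left input of a product is moved to its right input; \item III $\to$ VII: a coproduct $x$ whose left output is the right input of a product $y$ is replaced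 by $x$ standing on the output of $y$; \item VII $\to$ V: a coproduct $x$ standing on the output of a product $y$ is replaced by $x$ whose right output is the left input of $y$. \end{itemize} A \emph{valid flip} of a non-root edge of a rooted oriented triangulation is possible when the two triangles at this edge form a quadrilateral with four distinct corners: it removes the edge and draws the other diagonal with some orientation, all other edges, their orientations and the root being kept, in such a way that the result is again a rooted oriented triangulation of the sphere. \textbf{Theorem.} Each rule applies, in exactly one way, at every non-virtual edge of its source type, and can be reversed, in exactly one way, at every non-virtual edge of its target type. Under duality, the four rotation rules and their reverses at an edge of a PC prograph correspond exactly to the valid flips of the dual edge: each rotation or reverse rotation gives a valid flip, the edge that it creates being dual to the new diagonal, and each valid flip arises in this way from exactly one rotation or reverse rotation. The non-virtual edges whose dual edge admits no valid flip are exactly those of types II and VI. -/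

import Mathlib

universe u

/-! ## Maps on the sphere as permutations -/

/-- Number of orbits of a permutation. -/
noncomputable def orbitCount {D : Type u} (f : Equiv.Perm D) : ℕ :=
  Nat.card (Quotient (Equiv.Perm.SameCycle.setoid f))

/-- Two permutations of a finite set of darts, `φ` (turning around the cells of one kind) and the
involution `α` (exchanging the two darts of an edge), describe a connected map embedded in the
sphere: the action is transitive and the Euler characteristic is `2`. The orbits of `φ`, of `α` and
of `α * φ⁻¹` are the cells of one kind, the edges, and the cells of the dual kind. -/
def IsSphereMap {D : Type u} (φ α : Equiv.Perm D) : Prop :=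
  (∀ x y : D, ∃ g ∈ Subgroup.closure {φ, α}, g x = y) ∧
    orbitCount φ + orbitCount (α * φ⁻¹) = orbitCount α + 2

/-! ## PC prographs -/

/-- Output ports: a coproduct has a left and a right output, a product has one output.
Here `C` is the set of coproducts and `Pr` the set of products. -/
inductive Out (C Pr : Type u) : Type u
  | left (c : C)
  | right (c : C)
  | prod (p : Pr)

/-- Input ports: a coproduct has one input, a product has a left and a right input. -/
inductive Inp (C Pr : Type u) : Type u
  | cop (c : C)
  | left (p : Pr)
  | right (p : Pr)

/-- All ports of the operators. -/
abbrev Port (C Pr : Type u) : Type u := Out C Pr ⊕ Inp C Pr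

/-- The operator that carries an output port. -/
def Out.owner {C Pr : Type u} : Out C Pr → C ⊕ Pr
  | .left c => .inl c
  | .right c => .inl c
  | .prod p => .inr p

/-- The operator that carries an input port. -/
def Inp.owner {C Pr : Type u} : Inp C Pr → C ⊕ Pr
  | .cop c => .inl c
  | .left p => .inr p
  | .right p => .inr p

/-- Relabelling of the operators. -/
def Out.map {C Pr C' Pr' : Type u} (f : C → C') (g : Pr → Pr') : Out C Pr → Out C' Pr'
  | .left c => .left (f c)
  | .right c => .right (f c)
  | .prod p => .prod (g p)

/-- Relabelling of the operators. -/
def Inp.map {C Pr C' Pr' : Type u} (f : C → C') (g : Pr → Pr') : Inp C Pr → Inp C' Pr'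
  | .cop c => .cop (f c)
  | .left p => .left (g p)
  | .right p => .right (g p)

/-- Turning counterclockwise around each operator, when the flow goes upwards:
`input → right output → left output → input` around a coproduct,
`output → left input → right input → output` around a product. -/
def Port.turn (C Pr : Type u) : Equiv.Perm (Port C Pr) where
  toFun
    | .inr (.cop c) => .inl (.right c)
    | .inl (.right c) => .inl (.left c)
    | .inl (.left c) => .inr (.cop c)
    | .inl (.prod p) => .inr (.left p)
    | .inr (.left p) => .inr (.right p)
    | .inr (.right p) => .inl (.prod p)
  invFun
    | .inl (.right c) => .inr (.cop c)
    | .inl (.left c) => .inl (.right c)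
    | .inr (.cop c) => .inl (.left c)
    | .inr (.left p) => .inl (.prod p)
    | .inr (.right p) => .inr (.left p)
    | .inl (.prod p) => .inr (.right p)
  left_inv := by rintro ((c | c | p) | (c | p | p)) <;> rfl
  right_inv := by rintro ((c | c | p) | (c | p | p)) <;> rfl

/-- The involution of the ports that exchanges the two ends of each edge. -/
def Port.wire {C Pr : Type u} (next : Out C Pr ≃ Inp C Pr) : Equiv.Perm (Port C Pr) where
  toFun
    | .inl q => .inr (next q)
    | .inr i => .inl (next.symm i)
  invFun
    | .inl q => .inr (next q)
    | .inr i => .inl (next.symm i)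
  left_inv := by rintro (q | i) <;> simp
  right_inv := by rintro (q | i) <;> simp

/-- A PC prograph with set of coproducts `C` and set of products `Pr`. Its input (the unconnected
input of one coproduct) and its output (the unconnected output of one product `root`) are joined by
a virtual edge from the output to the input through the exterior face. Every edge, the virtual one
included, is recorded as the output port it leaves; `next` gives the input port it enters. -/
@[ext]
structure PCPrograph (C Pr : Type u) where
  next : Out C Pr ≃ Inp C Pr
  /-- the product whose output is the output of the prograph -/
  root : Pr
  finite_cop : Finite C
  finite_prod : Finite Pr
  /-- the virtual edge enters the input of a coproduct, the input of the prograph -/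
  root_next : ∃ c : C, next (.prod root) = .cop c
  /-- without the virtual edge, there is no directed cycle -/
  acyclic : ∀ o : C ⊕ Pr, ¬ Relation.TransGen
    (fun a b => ∃ q : Out C Pr, q ≠ .prod root ∧ q.owner = a ∧ (next q).owner = b) o o
  /-- the prograph is connected and, closed up by the virtual edge, drawn on the sphere with the
  prescribed cyclic order of the ports around each operator -/
  planar : IsSphereMap (Port.turn C Pr) (Port.wire next)

/-- The output port that feeds a given input port. -/
def PCPrograph.prev {C Pr : Type u} (P : PCPrograph C Pr) (i : Inp C Pr) : Out C Pr :=
  P.next.symm i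

/-- Isomorphism of PC prographs. -/
def PCPrograph.Isomorphic {C Pr C' Pr' : Type u} (P : PCPrograph C Pr) (Q : PCPrograph C' Pr') :
    Prop :=
  ∃ (f : C ≃ C') (g : Pr ≃ Pr'),
    (∀ q, Q.next (q.map f g) = (P.next q).map f g) ∧ Q.root = g P.root

/-- The nine types of edges. -/
inductive EdgeType
  | I | II | III | IV | V | VI | VII | VIII | IX

/-- The type of an edge, by the output port it leaves and the input port it enters. -/
def PCPrograph.edgeType {C Pr : Type u} (P : PCPrograph C Pr) (e : Out C Pr) : EdgeType :=
  match e, P.next e with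
  | .left _, .cop _ => .I
  | .left _, .left _ => .II
  | .left _, .right _ => .III
  | .right _, .cop _ => .IV
  | .right _, .left _ => .V
  | .right _, .right _ => .VI
  | .prod _, .cop _ => .VII
  | .prod _, .left _ => .VIII
  | .prod _, .right _ => .IX

/-- The four rotation rules. -/
inductive Rule
  | IVtoI | VIIItoIX | IIItoVII | VIItoV

/-- The type of the edge to which a rule applies. -/
def Rule.source : Rule → EdgeType
  | .IVtoI => .IV
  | .VIIItoIX => .VIII
  | .IIItoVII => .III
  | .VIItoV => .VII

/-- The type of the edge that a rule produces. -/
def Rule.target : Rule → EdgeType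
  | .IVtoI => .I
  | .VIIItoIX => .IX
  | .IIItoVII => .VII
  | .VIItoV => .V

/-- `Rotates r P e P' e'`: the rule `r` applied at the edge `e` of `P` gives `P'`, and `e'` is the
edge of `P'` between the two operators involved. The two operators keep their names; the
connections that are not mentioned, and the input and output of the prograph, do not change, and
neither `e` nor `e'` is the virtual edge. -/
def Rotates {C Pr : Type u} (r : Rule) (P : PCPrograph C Pr) (e : Out C Pr)
    (P' : PCPrograph C Pr) (e' : Out C Pr) : Prop :=
  P'.root = P.root ∧ e ≠ .prod P.root ∧ e' ≠ .prod P'.root ∧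
  match r with
  | .IVtoI =>
      -- coproduct `y` on the right output of `x` becomes `y` on the left output of `x`;
      -- the three upper branches keep their order from left to right
      ∃ x y : C, e = .right x ∧ e' = .left x ∧ P.next (.right x) = .cop y ∧
        P'.next (.left x) = .cop y ∧
        P'.next (.left y) = P.next (.left x) ∧
        P'.next (.right y) = P.next (.left y) ∧
        P'.next (.right x) = P.next (.right y) ∧
        ∀ q, q ≠ .left x → q ≠ .right x → q ≠ .left y → q ≠ .right y → P'.next q = P.next q
  | .VIIItoIX =>
      -- product `z` below the left input of `y` becomes `z` below the right input of `y`;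
      -- the three lower branches keep their order from left to right
      ∃ y z : Pr, e = .prod z ∧ e' = .prod z ∧ P.prev (.left y) = .prod z ∧
        P'.prev (.right y) = .prod z ∧
        P'.prev (.left y) = P.prev (.left z) ∧
        P'.prev (.left z) = P.prev (.right z) ∧
        P'.prev (.right z) = P.prev (.right y) ∧
        ∀ i, i ≠ .left y → i ≠ .right y → i ≠ .left z → i ≠ .right z → P'.prev i = P.prev i
  | .IIItoVII =>
      -- the left output of the coproduct `x` is the right input of the product `y`; afterwards `x`
      -- stands on the output of `y`
      ∃ (x : C) (y : Pr), e = .left x ∧ e' = .prod y ∧ P.next (.left x) = .right y ∧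
        P'.next (.prod y) = .cop x ∧
        P'.next (P.prev (.cop x)) = .right y ∧
        P'.next (.left x) = P.next (.prod y) ∧
        ∀ q, q ≠ .prod y → q ≠ P.prev (.cop x) → q ≠ .left x → P'.next q = P.next q
  | .VIItoV =>
      -- the coproduct `x` stands on the output of the product `y`; afterwards the right output of
      -- `x` is the left input of `y`
      ∃ (x : C) (y : Pr), e = .prod y ∧ e' = .right x ∧ P.next (.prod y) = .cop x ∧
        P'.next (.right x) = .left y ∧
        P'.next (P.prev (.left y)) = .cop x ∧
        P'.next (.prod y) = P.next (.right x) ∧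
        ∀ q, q ≠ .right x → q ≠ P.prev (.left y) → q ≠ .prod y → P'.next q = P.next q

/-- `P'` (with its edge `e'`) is obtained from `P` (with its edge `e`) by one of the four rotations
or by the reverse of one of them. -/
def RotationStep {C Pr : Type u} (P : PCPrograph C Pr) (e : Out C Pr)
    (P' : PCPrograph C Pr) (e' : Out C Pr) : Prop :=
  ∃ r : Rule, Rotates r P e P' e' ∨ Rotates r P' e' P e

/-! ## Rooted oriented triangulations of the sphere -/

/-- The permutation turning counterclockwise around the vertices, when `face` sends a dart to the
next dart along the boundary of the face on its left, and `opp` reverses darts. -/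
def vertexPerm {D : Type u} (face opp : Equiv.Perm D) : Equiv.Perm D := opp * face⁻¹

/-- A rooted, bipolar-oriented triangulation of the sphere (multiple edges are allowed, loops are
excluded by acyclicity), as a combinatorial map on the set `D` of darts (oriented sides of edges).
Each dart has the face on its left. -/
structure Triangulation (D : Type u) where
  finite : Finite D
  /-- next dart along the boundary of the face on the left -/
  face : Equiv.Perm D
  /-- the same edge in the other direction -/
  opp : Equiv.Perm D
  opp_opp : ∀ d, opp (opp d) = d
  opp_ne : ∀ d, opp d ≠ d
  /-- each face is a triangle -/
  triangle : ∀ d, face (face (face d)) = d ∧ face d ≠ d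
  sphere : IsSphereMap face opp
  /-- the darts that follow the orientation of their edge -/
  pos : D → Prop
  pos_opp : ∀ d, pos (opp d) ↔ ¬ pos d
  /-- the root edge, directed from the source to the sink -/
  root : D
  pos_root : pos root
  /-- there is no directed cycle -/
  acyclic : ∀ v : Quotient (Equiv.Perm.SameCycle.setoid (vertexPerm face opp)),
    ¬ Relation.TransGen (fun a b => ∃ d, pos d ∧ Quotient.mk _ d = a ∧ Quotient.mk _ (opp d) = b)
      v v
  /-- the origin of the root is the only source -/
  source_iff : ∀ v : Quotient (Equiv.Perm.SameCycle.setoid (vertexPerm face opp)),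
    (∀ d, pos d → Quotient.mk _ (opp d) ≠ v) ↔ v = Quotient.mk _ root
  /-- the end of the root is the only sink -/
  sink_iff : ∀ v : Quotient (Equiv.Perm.SameCycle.setoid (vertexPerm face opp)),
    (∀ d, pos d → Quotient.mk _ d ≠ v) ↔ v = Quotient.mk _ (opp root)

/-- The vertices of a triangulation. -/
abbrev Triangulation.Vertex {D : Type u} (T : Triangulation D) : Type u :=
  Quotient (Equiv.Perm.SameCycle.setoid (vertexPerm T.face T.opp))

/-- The vertex from which a dart starts. -/
def Triangulation.origin {D : Type u} (T : Triangulation D) (d : D) : T.Vertex :=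
  Quotient.mk _ d

/-- Isomorphism of rooted oriented triangulations. -/
def Triangulation.Isomorphic {D D' : Type u} (T : Triangulation D) (T' : Triangulation D') :
    Prop :=
  ∃ g : D ≃ D', (∀ d, T'.face (g d) = g (T.face d)) ∧ (∀ d, T'.opp (g d) = g (T.opp d)) ∧
    (∀ d, T'.pos (g d) ↔ T.pos d) ∧ T'.root = g T.root

/-- `Flip T d T' d'`: the edge of the dart `d` of `T` is not the root edge, the two triangles that
it borders form a quadrilateral (with four distinct corners) of which it is a diagonal, and removing
it and drawing the other diagonal, with some orientation, gives (a copy of) the rooted oriented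
triangulation `T'`; all the other edges, their orientations and the root are kept, and `d'` is one
of the two darts of the new diagonal. -/
def Flip {D D' : Type u} (T : Triangulation D) (d : D) (T' : Triangulation D') (d' : D') : Prop :=
  d ≠ T.root ∧ d ≠ T.opp T.root ∧
  [T.origin d, T.origin (T.opp d), T.origin (T.face (T.face d)),
    T.origin (T.face (T.face (T.opp d)))].Nodup ∧
  ∃ g : D ≃ D',
    (d' = g d ∨ d' = g (T.opp d)) ∧
    (∀ x, T'.opp (g x) = g (T.opp x)) ∧
    T'.root = g T.root ∧
    (∀ x, x ≠ d → x ≠ T.opp d → (T'.pos (g x) ↔ T.pos x)) ∧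
    -- the two new triangles
    T'.face (g d) = g (T.face (T.face d)) ∧
    T'.face (g (T.face (T.face d))) = g (T.face (T.opp d)) ∧
    T'.face (g (T.face (T.opp d))) = g d ∧
    T'.face (g (T.opp d)) = g (T.face (T.face (T.opp d))) ∧
    T'.face (g (T.face (T.face (T.opp d)))) = g (T.face d) ∧
    T'.face (g (T.face d)) = g (T.opp d) ∧
    -- the other triangles
    ∀ x, x ≠ d → x ≠ T.face d → x ≠ T.face (T.face d) → x ≠ T.opp d → x ≠ T.face (T.opp d) →
      x ≠ T.face (T.face (T.opp d)) → T'.face (g x) = g (T.face x)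

/-! ## Duality -/

/-- `T` is the dual of `P`: the triangles of `T` are the operators of `P`, the sides of a triangle
are the ports of the operator in the same cyclic order, two triangles are glued along a side when
the corresponding ports are connected, each edge of `T` is oriented from the left to the right of
the edge of `P` that it crosses (so that the dart with the triangle of an operator on its left is
positive exactly at the inputs), and the root edge of `T` crosses the virtual edge of `P`. -/
structure Duality {C Pr D : Type u} (P : PCPrograph C Pr) (T : Triangulation D) where
  dart : Port C Pr ≃ D
  dart_turn : ∀ a, dart (Port.turn C Pr a) = T.face (dart a)
  dart_wire : ∀ a, dart (Port.wire P.next a) = T.opp (dart a)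
  pos_out : ∀ q, ¬ T.pos (dart (.inl q))
  pos_inp : ∀ i, T.pos (dart (.inr i))
  dart_root : dart (.inr (P.next (.prod P.root))) = T.root

/-!
The ports of a prograph serve as the darts of its dual: turning around the operators is the face
permutation, and the wires are the edge involution.

On the sphere, the signed number of passages of a closed walk of operators across the edges of the
dual is the difference of a potential on the vertices of the dual, and vice versa. If the walk is
directed and avoids the virtual edge, the potential is monotone along the edges and takes equal
values at the ends of the root edge, which are the only source and the only sink; on an acyclic map
it is then constant, so the walk is trivial. Hence each of the two maps is acyclic if the other is.

A rotation rule permutes the four ports on the two sides of an edge cyclically, and this relabelling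
turns the dual triangulation into one that differs from it by a flip. It creates no directed cycle,
because two adjacent operators whose edge has neither type II nor type VI can be merged without
creating one, by the potential argument again. Conversely, a flip is determined by the orientation
of the new diagonal. The sides of the quadrilateral force this orientation, since no triangle is a
directed cycle, except for type VII; there both orientations occur, one by a rotation to type V and
one by a reverse rotation to type III. Finally, by Euler's formula a prograph has as many coproducts
as its dual has inner vertices, so that the dual of an edge of type II (type VI) is the only edge
into (out of) one of its ends, and no flip can remove it.
-/

/-! ## Flows and potentials on sphere maps -/

section Orbits

variable {D : Type u} {A : Type*}

/-- The orbits of a permutation: the cells of one kind of a map. -/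
abbrev Orbit (f : Equiv.Perm D) : Type u := Quotient (Equiv.Perm.SameCycle.setoid f)

/-- The orbit that contains a given element. -/
abbrev orbitOf (f : Equiv.Perm D) (x : D) : Orbit f := Quotient.mk _ x

lemma orbitOf_eq_iff {f : Equiv.Perm D} {x y : D} :
    orbitOf f x = orbitOf f y ↔ f.SameCycle x y :=
  Quotient.eq (r := Equiv.Perm.SameCycle.setoid f)

lemma orbitOf_apply (f : Equiv.Perm D) (x : D) : orbitOf f (f x) = orbitOf f x :=
  orbitOf_eq_iff.2 (Equiv.Perm.sameCycle_apply_left.2 (Equiv.Perm.SameCycle.refl f x))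

lemma apply_eq_of_mem_closure {S : Set (Equiv.Perm D)} {F : D → A}
    (hF : ∀ f ∈ S, ∀ x, F (f x) = F x) {g : Equiv.Perm D} (hg : g ∈ Subgroup.closure S) (x : D) :
    F (g x) = F x := by
  induction hg using Subgroup.closure_induction generalizing x with
  | mem g hg => exact hF g hg x
  | one => rfl
  | mul a b _ _ ha hb => rw [Equiv.Perm.mul_apply, ha, hb]
  | inv a _ ha => simpa using (ha (a⁻¹ x)).symm

lemma eq_of_sameCycle {f : Equiv.Perm D} {F : D → A} (hF : ∀ x, F (f x) = F x) {x y : D}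
    (hxy : f.SameCycle x y) : F x = F y := by
  obtain ⟨i, rfl⟩ := hxy
  have hi : f ^ i ∈ Subgroup.closure {f} :=
    Subgroup.zpow_mem _ (Subgroup.subset_closure (Set.mem_singleton f)) i
  exact (apply_eq_of_mem_closure (by simpa using hF) hi x).symm

/-- The map induced on the orbits by an invariant function. -/
def Orbit.lift {f : Equiv.Perm D} (F : D → A) (hF : ∀ x, F (f x) = F x) : Orbit f → A :=
  Quotient.lift F fun _ _ ↦ eq_of_sameCycle hF

lemma transitive_iff_forall_invariant {S : Set (Equiv.Perm D)} :
    (∀ x y : D, ∃ g ∈ Subgroup.closure S, g x = y) ↔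
      ∀ p : D → Prop, (∀ f ∈ S, ∀ x, p (f x) = p x) → ∀ x y, p x → p y := by
  refine ⟨fun h p hp x y hx ↦ ?_, fun h x y ↦ ?_⟩
  · obtain ⟨g, hg, rfl⟩ := h x y
    rwa [apply_eq_of_mem_closure hp hg]
  · refine h (fun y ↦ ∃ g ∈ Subgroup.closure S, g x = y) (fun f hf z ↦ propext ⟨?_, ?_⟩) x y
      ⟨1, Subgroup.one_mem _, rfl⟩
    · rintro ⟨g, hg, hgz⟩
      exact ⟨f⁻¹ * g, mul_mem (inv_mem (Subgroup.subset_closure hf)) hg, by simp [hgz]⟩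
    · rintro ⟨g, hg, rfl⟩
      exact ⟨f * g, mul_mem (Subgroup.subset_closure hf) hg, rfl⟩

/-- The bijection between the orbits of two conjugate permutations. -/
def Orbit.congr {D' : Type u} {f : Equiv.Perm D} {f' : Equiv.Perm D'} (e : D ≃ D')
    (h : ∀ x, e (f x) = f' (e x)) : Orbit f ≃ Orbit f' where
  toFun := Orbit.lift (fun x ↦ orbitOf f' (e x)) fun x ↦ by rw [h, orbitOf_apply]
  invFun := Orbit.lift (fun x ↦ orbitOf f (e.symm x)) fun x ↦ by
    rw [show e.symm (f' x) = f (e.symm x) by simp [Equiv.symm_apply_eq, h], orbitOf_apply]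
  left_inv q := by
    induction q using Quotient.inductionOn
    simp [Orbit.lift]
  right_inv q := by
    induction q using Quotient.inductionOn
    simp [Orbit.lift]

lemma orbitCount_congr {D' : Type u} {f : Equiv.Perm D} {f' : Equiv.Perm D'} (e : D ≃ D')
    (h : ∀ x, e (f x) = f' (e x)) : orbitCount f = orbitCount f' :=
  Nat.card_congr (Orbit.congr e h)

end Orbits

namespace IsSphereMap

variable {D : Type u} {φ α : Equiv.Perm D}

lemma congr {D' : Type u} {φ' α' : Equiv.Perm D'} (h : IsSphereMap φ α) (e : D ≃ D')
    (hφ : ∀ x, e (φ x) = φ' (e x)) (hα : ∀ x, e (α x) = α' (e x)) : IsSphereMap φ' α' := by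
  have hφ_inv : ∀ x, e (φ⁻¹ x) = φ'⁻¹ (e x) := fun x ↦ by
    rw [Equiv.Perm.eq_inv_iff_eq, ← hφ]
    simp
  refine ⟨?_, ?_⟩
  · have h1 := h.1
    rw [transitive_iff_forall_invariant] at h1 ⊢
    intro p hp x y hx
    simpa using h1 (p ∘ e) (by rintro f (rfl | rfl) x <;> simp [*]) (e.symm x) (e.symm y) (by simpa)
  · rw [← orbitCount_congr e hφ, ← orbitCount_congr e hα,
      ← orbitCount_congr (f := α * φ⁻¹) e fun x ↦ by
        rw [Equiv.Perm.mul_apply, hα, hφ_inv, Equiv.Perm.mul_apply], h.2]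

lemma dual (h : IsSphereMap φ α) : IsSphereMap (α * φ⁻¹) α := by
  refine ⟨?_, ?_⟩
  · have h1 := h.1
    rw [transitive_iff_forall_invariant] at h1 ⊢
    intro p hp
    have hα : ∀ x, p (α x) = p x := hp α (by simp)
    refine h1 p ?_
    rintro f (rfl | rfl) x
    · simpa [hα] using (hp _ (Set.mem_insert _ _) (f x)).symm
    · exact hα x
  · rw [← orbitCount_congr (f := φ) (f' := α * (α * φ⁻¹)⁻¹) α fun x ↦ by simp, add_comm]
    exact h.2

end IsSphereMap

section Cohomology

variable {D X : Type u} {φ α σ : Equiv.Perm D}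

/-- The functions on the darts that change sign when a dart is reversed. -/
def antisymmetricFunctions (α : Equiv.Perm D) : Submodule ℚ (D → ℚ) where
  carrier := {c | ∀ x, c (α x) = -c x}
  add_mem' hc hc' x := by simp [hc x, hc' x, add_comm]
  zero_mem' x := by simp
  smul_mem' r c hc x := by simp [hc x]

/-- The increments along the darts of a function on the orbits of `σ`. -/
def coboundary (σ α : Equiv.Perm D) : (Orbit σ → ℚ) →ₗ[ℚ] (D → ℚ) where
  toFun F x := F (orbitOf σ (α x)) - F (orbitOf σ x)
  map_add' F G := by ext x; simp; ring
  map_smul' r F := by ext x; simp; ring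

lemma coboundary_apply (F : Orbit σ → ℚ) (x : D) :
    coboundary σ α F x = F (orbitOf σ (α x)) - F (orbitOf σ x) := rfl

lemma range_coboundary_le (hα : Function.Involutive α) :
    LinearMap.range (coboundary σ α) ≤ antisymmetricFunctions α := by
  rintro _ ⟨F, rfl⟩ x
  simp [coboundary_apply, hα x]

lemma finrank_antisymmetricFunctions_le [Finite D] (α : Equiv.Perm D) :
    Module.finrank ℚ (antisymmetricFunctions α) ≤ orbitCount α := by
  have := Fintype.ofFinite (Orbit α)
  let restrict : antisymmetricFunctions α →ₗ[ℚ] (Orbit α → ℚ) :=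
    { toFun := fun c q ↦ c.1 q.out
      map_add' := fun _ _ ↦ rfl
      map_smul' := fun _ _ ↦ rfl }
  have restrict_injective : Function.Injective restrict := by
    refine LinearMap.ker_eq_bot.1 (LinearMap.ker_eq_bot'.2 ?_)
    rintro ⟨c, hc⟩ h
    ext x
    have hzero : c (orbitOf α x).out = 0 := congrFun h (orbitOf α x)
    have hx : (c (orbitOf α x).out = 0) = (c x = 0) :=
      eq_of_sameCycle (F := fun y ↦ c y = 0) (fun y ↦ by simp [hc y])
        (orbitOf_eq_iff.1 (Quotient.out_eq _))
    exact hx.mp hzero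
  have := LinearMap.finrank_le_finrank_of_injective restrict_injective
  rwa [Module.finrank_fintype_fun_eq_card, ← Nat.card_eq_fintype_card] at this

lemma orbitCount_le_finrank_range_coboundary [Finite D]
    (h : ∀ x y : D, ∃ g ∈ Subgroup.closure {σ, α}, g x = y) :
    orbitCount σ ≤ Module.finrank ℚ (LinearMap.range (coboundary σ α)) + 1 := by
  have := Fintype.ofFinite (Orbit σ)
  have hker : Module.finrank ℚ (LinearMap.ker (coboundary σ α)) ≤ 1 := by
    cases isEmpty_or_nonempty D with
    | inl _ =>
      have : IsEmpty (Orbit σ) := ⟨fun q ↦ Quotient.inductionOn q isEmptyElim⟩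
      simp [Module.finrank_zero_of_subsingleton]
    | inr hD =>
      obtain ⟨d⟩ := hD
      refine finrank_le_one ⟨fun _ ↦ 1, by ext; simp [coboundary_apply]⟩ ?_
      rintro ⟨F, hF⟩
      refine ⟨F (orbitOf σ d), Subtype.ext (funext fun q ↦ ?_)⟩
      induction q using Quotient.inductionOn with | h x =>
      obtain ⟨g, hg, rfl⟩ := h d x
      have hα : ∀ x, F (orbitOf σ (α x)) = F (orbitOf σ x) := fun x ↦
        sub_eq_zero.1 (congrFun hF x)
      have hinv : F (orbitOf σ (g d)) = F (orbitOf σ d) :=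
        apply_eq_of_mem_closure (F := fun x ↦ F (orbitOf σ x))
          (by rintro f (rfl | rfl) x; exacts [congrArg F (orbitOf_apply _ x), hα x]) hg d
      simp [hinv]
  have hrank := LinearMap.finrank_range_add_finrank_ker (coboundary σ α)
  rw [Module.finrank_fintype_fun_eq_card, ← Nat.card_eq_fintype_card] at hrank
  change Nat.card (Orbit σ) ≤ _
  lia

lemma dotProduct_coboundary [Fintype D] (hα : Function.Involutive α) {c : D → ℚ}
    (hc : c ∈ antisymmetricFunctions α) (F : Orbit σ → ℚ) :
    c ⬝ᵥ coboundary σ α F = -2 * c ⬝ᵥ (F ∘ orbitOf σ) := by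
  have hflip : ∑ x, c x * F (orbitOf σ (α x)) = -∑ x, c x * F (orbitOf σ x) := by
    rw [← Equiv.sum_comp α, ← Finset.sum_neg_distrib]
    exact Finset.sum_congr rfl fun x _ ↦ by rw [hc x, hα x, neg_mul]
  simp only [dotProduct, coboundary_apply, mul_sub, Finset.sum_sub_distrib, hflip,
    Function.comp_apply]
  ring

lemma coboundary_dotProduct_coboundary [Fintype D] (hα : Function.Involutive α) (F : Orbit φ → ℚ)
    (G : Orbit (α * φ⁻¹) → ℚ) : coboundary φ α F ⬝ᵥ coboundary (α * φ⁻¹) α G = 0 := by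
  have hG : ∀ x, orbitOf (α * φ⁻¹) (α x) = orbitOf (α * φ⁻¹) (φ x) := fun x ↦ by
    simpa using orbitOf_apply (α * φ⁻¹) (φ x)
  have hsum : ∑ x, F (orbitOf φ (α x)) * G (orbitOf _ x) = ∑ x, F (orbitOf φ x) * G (orbitOf _ x) :=
    calc ∑ x, F (orbitOf φ (α x)) * G (orbitOf _ x)
        = ∑ x, F (orbitOf φ x) * G (orbitOf _ (α x)) := by
          rw [← Equiv.sum_comp α]
          exact Finset.sum_congr rfl fun x _ ↦ by rw [hα x]
      _ = ∑ x, F (orbitOf φ (φ x)) * G (orbitOf _ (φ x)) :=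
          Finset.sum_congr rfl fun x _ ↦ by rw [hG, orbitOf_apply]
      _ = ∑ x, F (orbitOf φ x) * G (orbitOf _ x) :=
          Equiv.sum_comp φ fun x ↦ F (orbitOf φ x) * G (orbitOf _ x)
  rw [dotProduct_coboundary hα (range_coboundary_le hα ⟨F, rfl⟩)]
  simp [dotProduct, coboundary_apply, sub_mul, Finset.sum_sub_distrib, hsum]

lemma IsSphereMap.antisymmetricFunctions_le [Finite D] (h : IsSphereMap φ α)
    (hα : Function.Involutive α) :
    antisymmetricFunctions α ≤
      LinearMap.range (coboundary φ α) ⊔ LinearMap.range (coboundary (α * φ⁻¹) α) := by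
  have := Fintype.ofFinite D
  have hsup : LinearMap.range (coboundary φ α) ⊔ LinearMap.range (coboundary (α * φ⁻¹) α) ≤
      antisymmetricFunctions α := sup_le (range_coboundary_le hα) (range_coboundary_le hα)
  have hinf : LinearMap.range (coboundary φ α) ⊓ LinearMap.range (coboundary (α * φ⁻¹) α) = ⊥ := by
    rw [eq_bot_iff]
    rintro _ ⟨⟨F, rfl⟩, G, hGF⟩
    have horth := coboundary_dotProduct_coboundary hα F G
    rwa [hGF, dotProduct_self_eq_zero] at horth
  have hdim := Submodule.finrank_sup_add_finrank_inf_eq (LinearMap.range (coboundary φ α))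
    (LinearMap.range (coboundary (α * φ⁻¹) α))
  rw [hinf, finrank_bot] at hdim
  have hF := orbitCount_le_finrank_range_coboundary h.1
  have hV := orbitCount_le_finrank_range_coboundary h.dual.1
  have hE := finrank_antisymmetricFunctions_le α
  exact (Submodule.eq_of_le_of_finrank_le hsup (by have := h.2; lia)).ge

-- The discrete analogue of `H¹(S²) = 0`.
lemma IsSphereMap.mem_range_coboundary [Fintype D] (h : IsSphereMap φ α)
    (hα : Function.Involutive α) {c : D → ℚ} (hc : c ∈ antisymmetricFunctions α)
    (horth : ∀ G : Orbit (α * φ⁻¹) → ℚ, c ⬝ᵥ (G ∘ orbitOf _) = 0) :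
    c ∈ LinearMap.range (coboundary φ α) := by
  obtain ⟨_, ⟨F, rfl⟩, _, ⟨G, rfl⟩, rfl⟩ :=
    Submodule.mem_sup.1 (h.antisymmetricFunctions_le hα hc)
  have hG := dotProduct_coboundary hα hc G
  rw [horth, mul_zero, add_dotProduct, coboundary_dotProduct_coboundary hα, zero_add,
    dotProduct_self_eq_zero] at hG
  rw [hG, add_zero]
  exact ⟨F, rfl⟩

lemma exists_flow_of_transGen [Fintype D] {π : D → X} {p : D → Prop} (hα : Function.Involutive α)
    (hp : ∀ d, p d → ¬ p (α d)) {x y : X}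
    (h : Relation.TransGen (fun a b ↦ ∃ d, p d ∧ π d = a ∧ π (α d) = b) x y) :
    ∃ c ∈ antisymmetricFunctions α, (∀ d, p d → 0 ≤ c d) ∧
      (∀ d, ¬ p d → ¬ p (α d) → c d = 0) ∧ (∃ d, p d ∧ 0 < c d) ∧
      ∀ F : X → ℚ, c ⬝ᵥ (F ∘ π) = F x - F y := by
  classical
  let step : D → D → ℚ := fun d ↦ Pi.single d 1 - Pi.single (α d) 1
  have step_mem : ∀ d, step d ∈ antisymmetricFunctions α := fun d x ↦ by
    have hx : α x = d ↔ x = α d := hα.eq_iff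
    simp [step, Pi.single_apply, hx]
  have step_apply : ∀ {d e}, p d → ¬ p (α e) → step d e = if e = d then 1 else 0 := by
    intro d e hd he
    have : e ≠ α d := fun h ↦ he (by rwa [h, hα d])
    simp [step, Pi.single_apply, this]
  have step_eq_zero : ∀ d, p d → ∀ e, ¬ p e → ¬ p (α e) → step d e = 0 := fun d hd e he he' ↦ by
    rw [step_apply hd he', if_neg]
    rintro rfl
    exact he hd
  have step_nonneg : ∀ d, p d → ∀ e, p e → 0 ≤ step d e := fun d hd e he ↦ by
    rw [step_apply hd (hp e he)]; positivity
  have step_self : ∀ d, p d → step d d = 1 := fun d hd ↦ by simp [step_apply hd (hp d hd)]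
  have step_dotProduct : ∀ d (F : X → ℚ), step d ⬝ᵥ (F ∘ π) = F (π d) - F (π (α d)) := by
    simp [step]
  induction h with
  | single h =>
    obtain ⟨d, hd, rfl, rfl⟩ := h
    exact ⟨step d, step_mem d, step_nonneg d hd, step_eq_zero d hd,
      ⟨d, hd, by simp [step_self d hd]⟩, step_dotProduct d⟩
  | tail _ h ih =>
    obtain ⟨d, hd, rfl, rfl⟩ := h
    obtain ⟨c, hc, hnonneg, hzero, -, hsum⟩ := ih
    refine ⟨c + step d, add_mem hc (step_mem d),
      fun e he ↦ add_nonneg (hnonneg e he) (step_nonneg d hd e he),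
      fun e he he' ↦ by simp [hzero e he he', step_eq_zero d hd e he he'],
      ⟨d, hd, add_pos_of_nonneg_of_pos (hnonneg d hd) (by simp [step_self d hd])⟩, fun F ↦ ?_⟩
    rw [add_dotProduct, hsum, step_dotProduct, sub_add_sub_cancel]

-- The flow carried by a closed walk is a cocycle, hence has a potential.
lemma IsSphereMap.exists_potential_of_vertex_cycle [Finite D] (h : IsSphereMap φ α)
    (hα : Function.Involutive α) {π : D → X} (hπ : ∀ x y, π x = π y → (α * φ⁻¹).SameCycle x y)
    {p : D → Prop} (hp : ∀ d, p d → ¬ p (α d)) {x : X}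
    (hx : Relation.TransGen (fun a b ↦ ∃ d, p d ∧ π d = a ∧ π (α d) = b) x x) :
    ∃ f : D → ℚ, (∀ x, f (φ x) = f x) ∧ (∀ d, p d → f d ≤ f (α d)) ∧
      (∀ d, ¬ p d → ¬ p (α d) → f d = f (α d)) ∧ ∃ d, p d ∧ f d < f (α d) := by
  have := Fintype.ofFinite D
  obtain ⟨c, hc, hnonneg, hzero, ⟨d, hd, hpos⟩, hsum⟩ := exists_flow_of_transGen hα hp hx
  obtain ⟨F, rfl⟩ := h.mem_range_coboundary hα hc fun G ↦ by
    obtain ⟨H, hH⟩ := (Function.factorsThrough_iff (G ∘ orbitOf _)).1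
      fun x y hxy ↦ congrArg G (orbitOf_eq_iff.2 (hπ x y hxy))
    rw [hH, hsum, sub_self]
  exact ⟨F ∘ orbitOf φ, fun x ↦ congrArg F (orbitOf_apply φ x),
    fun d hd ↦ sub_nonneg.1 (hnonneg d hd),
    fun d hd hd' ↦ (sub_eq_zero.1 (hzero d hd hd')).symm, d, hd, sub_pos.1 hpos⟩

lemma IsSphereMap.exists_potential_of_face_cycle [Finite D] (h : IsSphereMap φ α)
    (hα : Function.Involutive α) {π : D → X} (hπ : ∀ x y, π x = π y → φ.SameCycle x y)
    {p : D → Prop} (hp : ∀ d, p d → ¬ p (α d)) {x : X}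
    (hx : Relation.TransGen (fun a b ↦ ∃ d, p d ∧ π d = a ∧ π (α d) = b) x x) :
    ∃ g : D → ℚ, (∀ x, g (α x) = g (φ x)) ∧ (∀ d, p d → g (α d) ≤ g d) ∧
      (∀ d, ¬ p d → ¬ p (α d) → g (α d) = g d) ∧ ∃ d, p d ∧ g (α d) < g d := by
  have hπ' : ∀ x y, π (α x) = π (α y) → (α * (α * φ⁻¹)⁻¹).SameCycle x y := fun x y hxy ↦ by
    have hconj := (hπ _ _ hxy).conj (g := α)
    rwa [hα, hα, mul_assoc, ← inv_inv φ, ← mul_inv_rev] at hconj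
  have hx' : Relation.TransGen (fun a b ↦ ∃ d, p (α d) ∧ π (α d) = a ∧ π (α (α d)) = b) x x :=
    hx.lift id fun a b ⟨d, hd, ha, hb⟩ ↦ ⟨α d, by simpa [hα d] using ⟨hd, ha, hb⟩⟩
  obtain ⟨g, hφ, hle, heq, d, hd, hlt⟩ :=
    h.dual.exists_potential_of_vertex_cycle hα hπ' (fun d hd hd' ↦ hp _ hd hd') hx'
  refine ⟨g, fun x ↦ by simpa using hφ (φ x), fun d hd ↦ ?_, fun d hd hd' ↦ ?_, α d, hd, ?_⟩
  · simpa [hα d] using hle (α d) (by simpa [hα d])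
  · simpa [hα d] using heq (α d) (by simpa [hα d]) (by simpa [hα d])
  · simpa [hα d] using hlt

end Cohomology

section FiniteRelations

variable {D X : Type*} {R : X → X → Prop}

lemma wellFounded_of_acyclic [Finite X] (h : ∀ x, ¬ Relation.TransGen R x x) : WellFounded R := by
  have : Std.Irrefl (Relation.TransGen R) := ⟨h⟩
  exact Subrelation.wf Relation.TransGen.single
    (Finite.wellFounded_of_trans_of_irrefl (Relation.TransGen R))

lemma acyclic_swap (h : ∀ x, ¬ Relation.TransGen R x x) (x : X) :
    ¬ Relation.TransGen (Function.swap R) x x :=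
  fun h' ↦ h x (Relation.transGen_swap.1 h')

lemma forall_not_rel_iff_eq_of_acyclic [Finite X] (h : ∀ x, ¬ Relation.TransGen R x x) {s : X}
    (hs : ∀ x, x ≠ s → ∃ w, R w x) (x : X) : (∀ w, ¬ R w x) ↔ x = s := by
  have eq_source : ∀ x, (∀ w, ¬ R w x) → x = s := fun x hx ↦ by
    by_contra hne
    obtain ⟨w, hw⟩ := hs x hne
    exact hx w hw
  refine ⟨eq_source x, ?_⟩
  rintro rfl
  obtain ⟨m, -, hm⟩ := (wellFounded_of_acyclic h).has_min Set.univ ⟨x, trivial⟩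
  obtain rfl := eq_source m fun w hw ↦ hm w trivial hw
  exact fun w hw ↦ hm w trivial hw

lemma eq_of_antitone_of_acyclic {A : Type*} [PartialOrder A] [Finite X]
    (h : ∀ x, ¬ Relation.TransGen R x x) {s t : X} (hs : ∀ x, x ≠ s → ∃ w, R w x)
    (ht : ∀ x, x ≠ t → ∃ w, R x w) {f : X → A} (hf : ∀ x y, R x y → f y ≤ f x)
    (hst : f s ≤ f t) (x y : X) : f x = f y := by
  have le_source : ∀ x, f x ≤ f s := fun x ↦ by
    induction x using (wellFounded_of_acyclic h).induction with | _ x ih =>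
    by_cases hx : x = s
    · rw [hx]
    · obtain ⟨w, hw⟩ := hs x hx
      exact (hf w x hw).trans (ih w hw)
  have sink_le : ∀ x, f t ≤ f x := fun x ↦ by
    induction x using (wellFounded_of_acyclic (acyclic_swap h)).induction with | _ x ih =>
    by_cases hx : x = t
    · rw [hx]
    · obtain ⟨w, hw⟩ := ht x hx
      exact (ih w hw).trans (hf x w hw)
  exact le_antisymm ((le_source x).trans (hst.trans (sink_le y)))
    ((le_source y).trans (hst.trans (sink_le x)))

lemma transGen_of_orbit [Finite D] (σ : Equiv.Perm D) {π : D → X} {s : D → Prop}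
    (hs : ∀ d, s d → s (σ d)) (hR : ∀ d, s d → R (π d) (π (σ d))) {d : D} (hd : s d) :
    Relation.TransGen R (π d) (π d) := by
  have hpow : ∀ n : ℕ, s ((σ ^ (n + 1)) d) ∧ Relation.TransGen R (π d) (π ((σ ^ (n + 1)) d)) := by
    intro n
    induction n with
    | zero => simpa using ⟨hs d hd, .single (hR d hd)⟩
    | succ n ih =>
      rw [pow_succ' σ (n + 1)]
      exact ⟨hs _ ih.1, ih.2.tail (hR _ ih.1)⟩
  have hreturn := (hpow (orderOf σ - 1)).2
  rwa [Nat.sub_add_cancel (orderOf_pos σ), pow_orderOf_eq_one] at hreturn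

end FiniteRelations

/-! ## The dual of a prograph -/

section Ports

variable {C Pr : Type u}

/-- The operator that carries a port. -/
def Port.owner : Port C Pr → C ⊕ Pr := Sum.elim Out.owner Inp.owner

lemma Port.owner_turn (a : Port C Pr) : Port.owner (Port.turn C Pr a) = Port.owner a := by
  rcases a with ((c | c | p) | (c | p | p)) <;> rfl

lemma Port.sameCycle_turn {a b : Port C Pr} (h : Port.owner a = Port.owner b) :
    (Port.turn C Pr).SameCycle a b := by
  refine (?_ : ∃ n : ℕ, (Port.turn C Pr ^ n) a = b).imp' (fun n : ℕ ↦ (n : ℤ)) fun n hn ↦ by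
    simpa using hn
  rcases a with ((c | c | p) | (c | p | p)) <;> rcases b with ((c' | c' | p') | (c' | p' | p')) <;>
    cases h <;> first | exact ⟨0, rfl⟩ | exact ⟨1, rfl⟩ | exact ⟨2, rfl⟩

@[simp]
lemma Port.wire_inl (next : Out C Pr ≃ Inp C Pr) (q : Out C Pr) :
    Port.wire next (.inl q) = .inr (next q) := rfl

@[simp]
lemma Port.wire_inr (next : Out C Pr ≃ Inp C Pr) (i : Inp C Pr) :
    Port.wire next (.inr i) = .inl (next.symm i) := rfl

lemma Port.wire_wire (next : Out C Pr ≃ Inp C Pr) : Function.Involutive (Port.wire next) := by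
  rintro (q | i) <;> simp

lemma Port.isRight_wire (next : Out C Pr ≃ Inp C Pr) (a : Port C Pr) :
    (Port.wire next a).isRight = !a.isRight := by
  rcases a with q | i <;> rfl

lemma Port.turn_turn_turn (a : Port C Pr) :
    Port.turn C Pr (Port.turn C Pr (Port.turn C Pr a)) = a := by
  rcases a with ((c | c | p) | (c | p | p)) <;> rfl

lemma Port.turn_ne (a : Port C Pr) : Port.turn C Pr a ≠ a := by
  rcases a with ((c | c | p) | (c | p | p)) <;> simp [Port.turn]

instance Port.finite [Finite C] [Finite Pr] : Finite (Port C Pr) := by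
  let code : Port C Pr → (C ⊕ Pr) × Bool × Bool := fun a ↦
    (Port.owner a, a.isRight, (Port.turn C Pr a).isRight)
  refine Finite.of_injective code ?_
  rintro ((c | c | p) | (c | p | p)) ((c' | c' | p') | (c' | p' | p')) h <;>
    simp_all [code, Port.owner, Out.owner, Inp.owner, Port.turn]

lemma exists_wire_eq {α : Equiv.Perm (Port C Pr)} (hα : Function.Involutive α)
    (h : ∀ a, (α a).isRight = !a.isRight) : ∃ next : Out C Pr ≃ Inp C Pr, Port.wire next = α := by
  have hout : ∀ q : Out C Pr, ∃ i, α (.inl q) = .inr i := fun q ↦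
    Sum.isRight_iff.1 (h (.inl q))
  have hinp : ∀ i : Inp C Pr, ∃ q, α (.inr i) = .inl q := fun i ↦
    Sum.isLeft_iff.1 (by simpa using h (.inr i))
  choose f hf using hout
  choose g hg using hinp
  refine ⟨⟨f, g, fun q ↦ Sum.inl_injective (β := Inp C Pr) ?_,
    fun i ↦ Sum.inr_injective (α := Out C Pr) ?_⟩, ?_⟩
  · rw [← hg, ← hf, hα]
  · rw [← hf, ← hg, hα]
  · ext (q | i)
    exacts [(hf q).symm, (hg i).symm]

end Ports

namespace PCPrograph

variable {C Pr : Type u} (P : PCPrograph C Pr)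

/-- The relation on the operators given by the non-virtual edges. -/
def Arc (a b : C ⊕ Pr) : Prop :=
  ∃ q : Out C Pr, q ≠ .prod P.root ∧ q.owner = a ∧ (P.next q).owner = b

variable {P} in
lemma arc_of_ne {q : Out C Pr} (h : q ≠ .prod P.root) : P.Arc q.owner (P.next q).owner :=
  ⟨q, h, rfl, rfl⟩

lemma exists_arc_to {o : C ⊕ Pr} (ho : o ≠ (P.next (.prod P.root)).owner) : ∃ o', P.Arc o' o := by
  obtain ⟨i, rfl⟩ : ∃ i : Inp C Pr, i.owner = o := by
    rcases o with c | p
    exacts [⟨.cop c, rfl⟩, ⟨.left p, rfl⟩]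
  refine ⟨_, P.next.symm i, ?_, rfl, by simp⟩
  intro hi
  simp [← hi] at ho

lemma exists_arc_from {o : C ⊕ Pr} (ho : o ≠ .inr P.root) : ∃ o', P.Arc o o' := by
  obtain ⟨q, rfl⟩ : ∃ q : Out C Pr, q.owner = o := by
    rcases o with c | p
    exacts [⟨.left c, rfl⟩, ⟨.prod p, rfl⟩]
  exact ⟨_, arc_of_ne (by rintro rfl; exact ho rfl)⟩

lemma eq_of_antitone (f : C ⊕ Pr → ℚ) (h : ∀ q, f (P.next q).owner ≤ f q.owner)
    (a b : C ⊕ Pr) : f a = f b := by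
  have := P.finite_cop
  have := P.finite_prod
  refine eq_of_antitone_of_acyclic P.acyclic (fun _ ↦ P.exists_arc_to)
    (fun _ ↦ P.exists_arc_from) ?_ (h (.prod P.root)) a b
  rintro _ _ ⟨q, -, rfl, rfl⟩
  exact h q

end PCPrograph

section Vertices

variable {D : Type u} {face opp : Equiv.Perm D}

lemma vertexPerm_apply_face (x : D) : vertexPerm face opp (face x) = opp x := by
  simp [vertexPerm]

lemma orbitOf_vertexPerm_opp (x : D) :
    orbitOf (vertexPerm face opp) (opp x) = orbitOf (vertexPerm face opp) (face x) := by
  rw [← vertexPerm_apply_face, orbitOf_apply]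

end Vertices

namespace PCPrograph

variable {C Pr : Type u} (P : PCPrograph C Pr)

/-- The permutation of the ports that turns around the faces of a prograph, the vertices of its
dual. -/
abbrev facePerm : Equiv.Perm (Port C Pr) := vertexPerm (Port.turn C Pr) (Port.wire P.next)

/-- The relation on the faces of a prograph given by the edges of its dual, the virtual one
included. -/
def FaceAdj (v w : Orbit P.facePerm) : Prop :=
  ∃ a : Port C Pr, a.isRight = true ∧ orbitOf P.facePerm a = v ∧
    orbitOf P.facePerm (Port.wire P.next a) = w

lemma acyclic_faceAdj (v : Orbit P.facePerm) : ¬ Relation.TransGen P.FaceAdj v v := by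
  intro hv
  have := P.finite_cop
  have := P.finite_prod
  obtain ⟨f, hf, hle, -, a, -, hlt⟩ := P.planar.exists_potential_of_vertex_cycle
    (Port.wire_wire P.next) (fun _ _ ↦ orbitOf_eq_iff.1) (by simp [Port.isRight_wire]) hv
  obtain ⟨F, hF⟩ := (Function.factorsThrough_iff (g := f) (f := Port.owner)).1
    fun a b hab ↦ eq_of_sameCycle hf (Port.sameCycle_turn hab)
  subst hF
  refine hlt.ne (P.eq_of_antitone F (fun q ↦ ?_) _ _)
  simpa [Port.owner] using hle (.inr (P.next q)) rfl

-- Around a face without an incoming side, each operator has an edge to the next one.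
lemma exists_faceAdj_to {v : Orbit P.facePerm}
    (hv : v ≠ orbitOf P.facePerm (.inr (P.next (.prod P.root)))) : ∃ w, P.FaceAdj w v := by
  have := P.finite_cop
  have := P.finite_prod
  by_contra! hn
  induction v using Quotient.inductionOn with | h a =>
  have hpos : ∀ x, orbitOf P.facePerm x = orbitOf P.facePerm a → x.isRight = true := by
    rintro (q | i) hx
    · exact absurd ⟨.inr (P.next q), rfl, rfl, by simpa using hx⟩ (hn _)
    · rfl
  refine P.acyclic _ (transGen_of_orbit P.facePerm (π := Port.owner)
    (s := fun x ↦ orbitOf P.facePerm x = orbitOf P.facePerm a)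
    (fun x hx ↦ (orbitOf_apply _ x).trans hx) (fun x hx ↦ ?_) (d := a) rfl)
  obtain ⟨y, rfl⟩ := (Port.turn C Pr).surjective x
  rw [← orbitOf_vertexPerm_opp] at hx
  rcases y with q | i
  · rw [Port.owner_turn, vertexPerm_apply_face]
    refine arc_of_ne ?_
    rintro rfl
    exact hv hx.symm
  · exact absurd (hpos _ hx) (by simp)

lemma exists_faceAdj_from {v : Orbit P.facePerm}
    (hv : v ≠ orbitOf P.facePerm (.inl (.prod P.root))) : ∃ w, P.FaceAdj v w := by
  have := P.finite_cop
  have := P.finite_prod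
  by_contra! hn
  induction v using Quotient.inductionOn with | h a =>
  have hneg : ∀ i : Inp C Pr, orbitOf P.facePerm (.inr i) ≠ orbitOf P.facePerm a :=
    fun i hi ↦ hn _ ⟨.inr i, rfl, hi, rfl⟩
  refine acyclic_swap P.acyclic _ (transGen_of_orbit P.facePerm (π := Port.owner)
    (s := fun x ↦ orbitOf P.facePerm x = orbitOf P.facePerm a)
    (fun x hx ↦ (orbitOf_apply _ x).trans hx) (fun x hx ↦ ?_) (d := a) rfl)
  obtain ⟨y, rfl⟩ := (Port.turn C Pr).surjective x
  rw [← orbitOf_vertexPerm_opp] at hx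
  rcases y with q | i
  · exact absurd hx (hneg _)
  · rw [Port.owner_turn, vertexPerm_apply_face]
    refine ⟨P.next.symm i, ?_, rfl, by simp [Port.owner]⟩
    rintro h
    exact hv (by simpa [h] using hx.symm)

/-- The dual triangulation, with the ports as darts. -/
def dual : Triangulation (Port C Pr) where
  finite := have := P.finite_cop; have := P.finite_prod; inferInstance
  face := Port.turn C Pr
  opp := Port.wire P.next
  opp_opp := Port.wire_wire P.next
  opp_ne a := by rcases a with q | i <;> simp
  triangle a := ⟨Port.turn_turn_turn a, Port.turn_ne a⟩
  sphere := P.planar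
  pos a := a.isRight = true
  pos_opp a := by simp [Port.isRight_wire]
  root := .inr (P.next (.prod P.root))
  pos_root := rfl
  acyclic := P.acyclic_faceAdj
  source_iff v := by
    have := P.finite_cop
    have := P.finite_prod
    rw [← forall_not_rel_iff_eq_of_acyclic P.acyclic_faceAdj (fun _ ↦ P.exists_faceAdj_to)]
    exact ⟨fun h w ⟨a, ha, _, hav⟩ ↦ h a ha hav, fun h a ha hav ↦ h _ ⟨a, ha, rfl, hav⟩⟩
  sink_iff v := by
    have := P.finite_cop
    have := P.finite_prod
    rw [Port.wire_inr, Equiv.symm_apply_apply, ← forall_not_rel_iff_eq_of_acyclic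
      (acyclic_swap P.acyclic_faceAdj) (fun _ ↦ P.exists_faceAdj_from)]
    exact ⟨fun h w ⟨a, ha, hav, _⟩ ↦ h a ha hav, fun h a ha hav ↦ h _ ⟨a, ha, hav, rfl⟩⟩

end PCPrograph

/-! ## The prograph of a triangulation -/

namespace Triangulation

variable {D D' : Type u} (T : Triangulation D)

/-- The relation on the vertices given by the edges. -/
def Adj (v w : T.Vertex) : Prop := ∃ d, T.pos d ∧ T.origin d = v ∧ T.origin (T.opp d) = w

lemma origin_eq_iff {x y : D} : T.origin x = T.origin y ↔ (vertexPerm T.face T.opp).SameCycle x y :=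
  orbitOf_eq_iff

lemma eq_of_origin_eq {A : Type*} {F : D → A} (hF : ∀ x, F (T.opp x) = F (T.face x)) {x y : D}
    (h : T.origin x = T.origin y) : F x = F y := by
  refine eq_of_sameCycle (fun z ↦ ?_) (T.origin_eq_iff.1 h)
  obtain ⟨z, rfl⟩ := T.face.surjective z
  rw [vertexPerm_apply_face, hF]

lemma acyclic_adj (v : T.Vertex) : ¬ Relation.TransGen T.Adj v v := T.acyclic v

lemma origin_opp (d : D) : T.origin (T.opp d) = T.origin (T.face d) := orbitOf_vertexPerm_opp d

lemma face_face_face (d : D) : T.face (T.face (T.face d)) = d := (T.triangle d).1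

lemma not_pos_opp_root : ¬ T.pos (T.opp T.root) := by simp [T.pos_opp, T.pos_root]

variable {T}

lemma adj_of_pos {d : D} (h : T.pos d) : T.Adj (T.origin d) (T.origin (T.face d)) :=
  ⟨d, h, rfl, T.origin_opp d⟩

lemma adj_of_neg {d : D} (h : ¬ T.pos d) : T.Adj (T.origin (T.face d)) (T.origin d) :=
  ⟨T.opp d, (T.pos_opp d).2 h, T.origin_opp d, by rw [T.opp_opp]⟩

lemma not_adj_source (v : T.Vertex) : ¬ T.Adj v (T.origin T.root) := by
  rintro ⟨d, hd, -, h⟩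
  exact (T.source_iff _).2 rfl d hd h

lemma not_adj_sink (v : T.Vertex) : ¬ T.Adj (T.origin (T.opp T.root)) v := by
  rintro ⟨d, hd, h, -⟩
  exact (T.sink_iff _).2 rfl d hd h

lemma exists_adj_of_ne_source {v : T.Vertex} (h : v ≠ T.origin T.root) : ∃ w, T.Adj w v := by
  by_contra! hn
  exact h ((T.source_iff v).1 fun d hd h ↦ hn _ ⟨d, hd, rfl, h⟩)

lemma exists_adj_of_ne_sink {v : T.Vertex} (h : v ≠ T.origin (T.opp T.root)) :
    ∃ w, T.Adj v w := by
  by_contra! hn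
  exact h ((T.sink_iff v).1 fun d hd h ↦ hn _ ⟨d, hd, h, rfl⟩)

instance finite_vertex : Finite T.Vertex :=
  have := T.finite
  inferInstanceAs (Finite (Quotient _))

lemma eq_of_antitone {f : T.Vertex → ℚ} (hf : ∀ v w, T.Adj v w → f w ≤ f v)
    (hroot : f (T.origin T.root) ≤ f (T.origin (T.opp T.root))) (v w : T.Vertex) : f v = f w :=
  eq_of_antitone_of_acyclic T.acyclic_adj (fun _ ↦ exists_adj_of_ne_source)
    (fun _ ↦ exists_adj_of_ne_sink) hf hroot v w

lemma exists_neg_of_triangle (d : D) :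
    ¬ T.pos d ∨ ¬ T.pos (T.face d) ∨ ¬ T.pos (T.face (T.face d)) := by
  by_contra! h
  obtain ⟨h₁, h₂, h₃⟩ := h
  have hclose := adj_of_pos h₃
  rw [T.face_face_face] at hclose
  exact T.acyclic_adj _ (((Relation.TransGen.single (adj_of_pos h₁)).tail (adj_of_pos h₂)).tail
    hclose)

lemma exists_pos_of_triangle (d : D) :
    T.pos d ∨ T.pos (T.face d) ∨ T.pos (T.face (T.face d)) := by
  by_contra! h
  obtain ⟨h₁, h₂, h₃⟩ := h
  have hclose := adj_of_neg h₃
  rw [T.face_face_face] at hclose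
  exact T.acyclic_adj _ (((Relation.TransGen.single hclose).tail (adj_of_neg h₂)).tail
    (adj_of_neg h₁))

lemma not_pos_face_root : ¬ T.pos (T.face T.root) := fun h ↦ by
  have hadj := adj_of_pos h
  rw [← T.origin_opp] at hadj
  exact not_adj_sink _ hadj

lemma not_pos_face_face_root : ¬ T.pos (T.face (T.face T.root)) := fun h ↦ by
  have hadj := adj_of_pos h
  rw [T.face_face_face] at hadj
  exact not_adj_source _ hadj

lemma pos_face_opp_root : T.pos (T.face (T.opp T.root)) := by
  by_contra h
  have hadj := adj_of_neg h
  rw [← T.origin_opp (T.opp T.root), T.opp_opp] at hadj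
  exact not_adj_source _ hadj

lemma pos_face_face_opp_root : T.pos (T.face (T.face (T.opp T.root))) := by
  by_contra h
  have hadj := adj_of_neg h
  rw [T.face_face_face] at hadj
  exact not_adj_sink _ hadj

lemma ext {T' : Triangulation D} (hface : T.face = T'.face) (hopp : T.opp = T'.opp)
    (hpos : ∀ d, T.pos d ↔ T'.pos d) (hroot : T.root = T'.root) : T = T' := by
  rcases T with ⟨_, _, _⟩
  rcases T' with ⟨_, _, _⟩
  obtain rfl := funext fun d ↦ propext (hpos d)
  obtain rfl : _ = _ := hface
  obtain rfl : _ = _ := hopp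
  obtain rfl : _ = _ := hroot
  rfl

/-- The copy of a triangulation on another set of darts. -/
def map (T : Triangulation D) (e : D ≃ D') : Triangulation D' :=
  have hface : ∀ x, e (T.face x) = e.permCongr T.face (e x) := by simp
  have hopp : ∀ x, e (T.opp x) = e.permCongr T.opp (e x) := by simp
  let vertexEquiv : T.Vertex ≃ Orbit (vertexPerm (e.permCongr T.face) (e.permCongr T.opp)) :=
    Orbit.congr e fun x ↦ by
      obtain ⟨x, rfl⟩ := T.face.surjective x
      rw [vertexPerm_apply_face, hface, vertexPerm_apply_face, hopp]
  have hvertex : ∀ x, vertexEquiv.symm (orbitOf _ x) = T.origin (e.symm x) := fun _ ↦ rfl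
  { finite := have := T.finite; .of_equiv D e
    face := e.permCongr T.face
    opp := e.permCongr T.opp
    opp_opp := fun d ↦ by simp [T.opp_opp]
    opp_ne := fun d ↦ by simpa [← Equiv.eq_symm_apply] using T.opp_ne (e.symm d)
    triangle := fun d ↦ by simpa [← Equiv.eq_symm_apply] using T.triangle (e.symm d)
    sphere := T.sphere.congr e hface hopp
    pos := fun d ↦ T.pos (e.symm d)
    pos_opp := fun d ↦ by simp [T.pos_opp]
    root := e T.root
    pos_root := by simpa using T.pos_root
    acyclic := fun v hv ↦ T.acyclic_adj (vertexEquiv.symm v) <| hv.lift _ fun a b ⟨d, hd, ha, hb⟩ ↦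
      ⟨e.symm d, hd, by rw [← hvertex, ← ha], by rw [← hb]; simp [hvertex]⟩
    source_iff := fun v ↦ by
      rw [← vertexEquiv.symm.injective.eq_iff, hvertex, Equiv.symm_apply_apply]
      refine Iff.trans ?_ (T.source_iff (vertexEquiv.symm v))
      rw [e.symm.forall_congr_left]
      simp [← vertexEquiv.symm.injective.eq_iff, hvertex, Triangulation.origin]
    sink_iff := fun v ↦ by
      rw [← vertexEquiv.symm.injective.eq_iff, hvertex, ← hopp, Equiv.symm_apply_apply]
      refine Iff.trans ?_ (T.sink_iff (vertexEquiv.symm v))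
      rw [e.symm.forall_congr_left]
      simp [← vertexEquiv.symm.injective.eq_iff, hvertex, Triangulation.origin] }

variable {C Pr : Type u}

lemma acyclic_of_face_eq_turn {T : Triangulation (Port C Pr)} (hface : T.face = Port.turn C Pr)
    (o : C ⊕ Pr) :
    ¬ Relation.TransGen (fun o o' ↦ ∃ a, (¬ T.pos a ∧ a ≠ T.opp T.root) ∧ Port.owner a = o ∧
      Port.owner (T.opp a) = o') o o := by
  intro ho
  have := T.finite
  obtain ⟨g, hg, hle, heq, a, -, hlt⟩ := T.sphere.exists_potential_of_face_cycle T.opp_opp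
    (fun x y hxy ↦ hface ▸ Port.sameCycle_turn hxy) (fun a ha ha' ↦ ha'.1 ((T.pos_opp a).2 ha.1)) ho
  obtain ⟨G, rfl⟩ := (Function.factorsThrough_iff (g := g) (f := T.origin)).1
    fun x y hxy ↦ T.eq_of_origin_eq hg hxy
  have hroot : G (T.origin (T.opp T.root)) = G (T.origin T.root) :=
    heq T.root (fun h ↦ h.1 T.pos_root) (fun h ↦ h.2 rfl)
  refine hlt.ne (neg_injective (eq_of_antitone (f := fun v ↦ -G v) ?_ (by rw [hroot]) _ _))
  rintro _ _ ⟨d, hd, rfl, rfl⟩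
  by_cases hdr : d = T.root
  · rw [hdr, hroot]
  · simpa [T.opp_opp] using hle (T.opp d)
      ⟨fun h ↦ (T.pos_opp d).1 h hd, fun h ↦ hdr (T.opp.injective h)⟩

lemma exists_root_eq {T : Triangulation (Port C Pr)} (hface : T.face = Port.turn C Pr)
    (hpos : ∀ a, T.pos a ↔ a.isRight = true) :
    (∃ c, T.root = .inr (.cop c)) ∧ ∃ p, T.opp T.root = .inl (.prod p) := by
  have h₁ := T.pos_root
  have h₂ := T.not_pos_face_root
  have h₃ := T.not_pos_face_face_root
  have h₁' := T.not_pos_opp_root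
  have h₂' := T.pos_face_opp_root
  have h₃' := T.pos_face_face_opp_root
  rw [hpos, hface] at h₂ h₃ h₂' h₃'
  rw [hpos] at h₁ h₁'
  constructor
  · generalize T.root = a at h₁ h₂ h₃
    rcases a with ((c | c | p) | (c | p | p)) <;> simp_all [Port.turn]
  · generalize T.opp T.root = a at h₁' h₂' h₃'
    rcases a with ((c | c | p) | (c | p | p)) <;> simp_all [Port.turn]

lemma exists_eq_dual {T : Triangulation (Port C Pr)} (hface : T.face = Port.turn C Pr)
    (hpos : ∀ a, T.pos a ↔ a.isRight = true) : ∃ P : PCPrograph C Pr, P.dual = T := by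
  obtain ⟨next, hnext⟩ := exists_wire_eq T.opp_opp fun a ↦ by
    rw [Bool.eq_iff_iff, ← hpos, T.pos_opp, hpos]
    simp
  obtain ⟨⟨c, hc⟩, p, hp⟩ := exists_root_eq hface hpos
  have hroot : T.root = .inr (next (.prod p)) := by
    rw [← T.opp_opp T.root, hp, ← hnext, Port.wire_inl]
  have := T.finite
  let P : PCPrograph C Pr :=
    { next := next
      root := p
      finite_cop := .of_injective (fun c ↦ (.inr (.cop c) : Port C Pr)) fun _ _ h ↦ by simpa using h
      finite_prod := .of_injective (fun p ↦ (.inl (.prod p) : Port C Pr)) fun _ _ h ↦ by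
        simpa using h
      root_next := ⟨c, by simpa [hroot] using hc⟩
      acyclic := fun o ho ↦ acyclic_of_face_eq_turn hface o <| ho.lift id <| by
        rintro _ _ ⟨q, hq, rfl, rfl⟩
        exact ⟨.inl q, ⟨by simp [hpos], by simpa [hp] using hq⟩, rfl, by rw [← hnext]; rfl⟩
      planar := hface ▸ hnext ▸ T.sphere }
  exact ⟨P, ext hface.symm hnext (fun a ↦ (hpos a).symm) hroot.symm⟩

/-- The triangles that correspond to coproducts, represented by their only positive side. -/
abbrev Coproduct (T : Triangulation D) : Type u :=
  {d // T.pos d ∧ ¬ T.pos (T.face d) ∧ ¬ T.pos (T.face (T.face d))}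

/-- The triangles that correspond to products, represented by their only negative side. -/
abbrev Product (T : Triangulation D) : Type u :=
  {d // ¬ T.pos d ∧ T.pos (T.face d) ∧ T.pos (T.face (T.face d))}

/-- The side of a triangle that corresponds to a port of the dual operator. -/
def side (T : Triangulation D) : Port T.Coproduct T.Product → D
  | .inr (.cop c) => c
  | .inl (.right c) => T.face c
  | .inl (.left c) => T.face (T.face c)
  | .inl (.prod p) => p
  | .inr (.left p) => T.face p
  | .inr (.right p) => T.face (T.face p)

lemma side_turn (T : Triangulation D) (a) : T.side (Port.turn _ _ a) = T.face (T.side a) := by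
  rcases a with ((c | c | p) | (c | p | p)) <;> simp [side, Port.turn, T.face_face_face]

lemma pos_side_iff (T : Triangulation D) (a) : T.pos (T.side a) ↔ a.isRight = true := by
  rcases a with ((c | c | p) | (c | p | p)) <;>
    simp only [side, Sum.isRight_inl, Sum.isRight_inr, Bool.false_eq_true, iff_true, iff_false]
  exacts [c.2.2.2, c.2.2.1, p.2.1, c.2.1, p.2.2.1, p.2.2.2]

lemma side_injective (T : Triangulation D) : Function.Injective T.side := by
  intro a b h
  have hsign : ∀ {x y}, T.side x = T.side y → (x.isRight = true ↔ y.isRight = true) :=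
    fun h ↦ by rw [← pos_side_iff, h, pos_side_iff]
  have hturn : ∀ {x y}, T.side x = T.side y →
      T.side (Port.turn _ _ x) = T.side (Port.turn _ _ y) := fun h ↦ by rw [side_turn, h, side_turn]
  have h₁ := hsign h
  have h₂ := hsign (hturn h)
  have h₃ := hsign (hturn (hturn h))
  clear hsign hturn
  rcases a with ((c | c | p) | (c | p | p)) <;> rcases b with ((c | c | p) | (c | p | p)) <;>
    first
    | (simp [Port.turn] at h₁ h₂ h₃; done)
    | simpa [side, Subtype.ext_iff] using h

lemma side_surjective (T : Triangulation D) : Function.Surjective T.side := by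
  intro d
  have hcycle := T.face_face_face d
  have hneg := T.exists_neg_of_triangle d
  have hpos := T.exists_pos_of_triangle d
  by_cases h₁ : T.pos d <;> by_cases h₂ : T.pos (T.face d) <;>
    by_cases h₃ : T.pos (T.face (T.face d))
  · simp_all
  · exact ⟨.inr (.left ⟨T.face (T.face d), by simp_all⟩), hcycle⟩
  · exact ⟨.inr (.right ⟨T.face d, by simp_all⟩), hcycle⟩
  · exact ⟨.inr (.cop ⟨d, h₁, h₂, h₃⟩), rfl⟩
  · exact ⟨.inl (.prod ⟨d, h₁, h₂, h₃⟩), rfl⟩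
  · exact ⟨.inl (.left ⟨T.face d, by simp_all⟩), hcycle⟩
  · exact ⟨.inl (.right ⟨T.face (T.face d), by simp_all⟩), hcycle⟩
  · simp_all

lemma exists_map_eq_dual (T : Triangulation D) :
    ∃ (C Pr : Type u) (e : D ≃ Port C Pr) (P : PCPrograph C Pr), P.dual = T.map e := by
  let e := (Equiv.ofBijective T.side ⟨T.side_injective, T.side_surjective⟩).symm
  refine ⟨T.Coproduct, T.Product, e, exists_eq_dual (Equiv.ext fun a ↦ ?_) fun a ↦ T.pos_side_iff a⟩
  change e (T.face (T.side a)) = _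
  rw [← side_turn]
  exact e.apply_symm_apply _

end Triangulation

namespace Triangulation

variable {D D' D'' : Type u}

@[simp]
lemma map_face_apply (T : Triangulation D) (e : D ≃ D') (x : D) :
    (T.map e).face (e x) = e (T.face x) := by
  simp [map]

@[simp]
lemma map_opp_apply (T : Triangulation D) (e : D ≃ D') (x : D) :
    (T.map e).opp (e x) = e (T.opp x) := by
  simp [map]

@[simp]
lemma map_pos_apply (T : Triangulation D) (e : D ≃ D') (x : D) :
    (T.map e).pos (e x) ↔ T.pos x := by
  simp [map]

@[simp]
lemma map_root (T : Triangulation D) (e : D ≃ D') : (T.map e).root = e T.root := rfl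

lemma map_eq_iff {T : Triangulation D} {e : D ≃ D'} {T' : Triangulation D'} :
    T.map e = T' ↔ (∀ x, T'.face (e x) = e (T.face x)) ∧ (∀ x, T'.opp (e x) = e (T.opp x)) ∧
      (∀ x, T'.pos (e x) ↔ T.pos x) ∧ T'.root = e T.root := by
  constructor
  · rintro rfl
    simp
  · rintro ⟨hface, hopp, hpos, hroot⟩
    refine ext (Equiv.ext fun x ↦ ?_) (Equiv.ext fun x ↦ ?_) (fun x ↦ ?_) hroot.symm <;>
      obtain ⟨x, rfl⟩ := e.surjective x <;> simp [hface, hopp, hpos]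

lemma map_map (T : Triangulation D) (e : D ≃ D') (e' : D' ≃ D'') :
    (T.map e).map e' = T.map (e.trans e') :=
  (map_eq_iff.2 (by simp [map])).symm

@[simp]
lemma map_refl (T : Triangulation D) : T.map (Equiv.refl D) = T := map_eq_iff.2 (by simp)

lemma isomorphic_iff {T : Triangulation D} {T' : Triangulation D'} :
    T.Isomorphic T' ↔ ∃ e : D ≃ D', T.map e = T' := by
  simp only [map_eq_iff, Isomorphic]

end Triangulation

section Isomorphisms

variable {C Pr C' Pr' : Type u}

/-- Relabelling of the operators, on the ports. -/
abbrev Port.map (f : C → C') (g : Pr → Pr') : Port C Pr → Port C' Pr' :=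
  Sum.map (Out.map f g) (Inp.map f g)

lemma Port.turn_map (f : C → C') (g : Pr → Pr') (a : Port C Pr) :
    Port.turn C' Pr' (Port.map f g a) = Port.map f g (Port.turn C Pr a) := by
  rcases a with ((c | c | p) | (c | p | p)) <;> rfl

lemma Port.exists_eq_map {κ : Port C Pr → Port C' Pr'}
    (hturn : ∀ a, Port.turn C' Pr' (κ a) = κ (Port.turn C Pr a))
    (hright : ∀ a, (κ a).isRight = a.isRight) : ∃ f g, κ = Port.map f g := by
  have hsign (a) : (κ a).isRight = a.isRight ∧
      (Port.turn _ _ (κ a)).isRight = (Port.turn _ _ a).isRight ∧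
      (Port.turn _ _ (Port.turn _ _ (κ a))).isRight =
        (Port.turn _ _ (Port.turn _ _ a)).isRight := by
    simp only [hturn, hright, and_self]
  have hcop (c) : ∃ c', κ (.inr (.cop c)) = .inr (.cop c') := by
    have := hsign (.inr (.cop c))
    rcases h : κ (.inr (.cop c)) with ((c' | c' | p') | (c' | p' | p')) <;>
      simp [h, Port.turn] at this ⊢
  have hprod (p) : ∃ p', κ (.inl (.prod p)) = .inl (.prod p') := by
    have := hsign (.inl (.prod p))
    rcases h : κ (.inl (.prod p)) with ((c' | c' | p') | (c' | p' | p')) <;>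
      simp [h, Port.turn] at this ⊢
  choose f hf using hcop
  choose g hg using hprod
  have hstep {a} (h : κ a = Port.map f g a) :
      κ (Port.turn _ _ a) = Port.map f g (Port.turn _ _ a) := by
    rw [← hturn, h, Port.turn_map]
  refine ⟨f, g, funext ?_⟩
  rintro ((c | c | p) | (c | p | p))
  exacts [hstep (hstep (hf c)), hstep (hf c), hg p, hf c, hstep (hg p), hstep (hstep (hg p))]

lemma Port.exists_eq_map_equiv {κ : Port C Pr ≃ Port C' Pr'}
    (hturn : ∀ a, Port.turn C' Pr' (κ a) = κ (Port.turn C Pr a))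
    (hright : ∀ a, (κ a).isRight = a.isRight) :
    ∃ (f : C ≃ C') (g : Pr ≃ Pr'), κ = Port.map f g := by
  obtain ⟨f, g, hκ⟩ := Port.exists_eq_map hturn hright
  obtain ⟨f', g', hκ'⟩ := Port.exists_eq_map (κ := κ.symm)
    (fun a ↦ by rw [Equiv.eq_symm_apply, ← hturn, Equiv.apply_symm_apply])
    (fun a ↦ by rw [← hright, Equiv.apply_symm_apply])
  have hleft (a) : Port.map f' g' (Port.map f g a) = a := by rw [← hκ, ← hκ', κ.symm_apply_apply]
  have hright (a) : Port.map f g (Port.map f' g' a) = a := by rw [← hκ, ← hκ', κ.apply_symm_apply]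
  refine ⟨⟨f, f', fun c ↦ ?_, fun c ↦ ?_⟩, ⟨g, g', fun p ↦ ?_, fun p ↦ ?_⟩, hκ⟩
  · simpa [Inp.map] using hleft (.inr (.cop c))
  · simpa [Inp.map] using hright (.inr (.cop c))
  · simpa [Out.map] using hleft (.inl (.prod p))
  · simpa [Out.map] using hright (.inl (.prod p))

lemma Port.bijective_map (f : C ≃ C') (g : Pr ≃ Pr') : Function.Bijective (Port.map f g) := by
  refine Function.bijective_iff_has_inverse.2 ⟨Port.map f.symm g.symm, ?_, ?_⟩ <;>
    rintro ((c | c | p) | (c | p | p)) <;> simp [Out.map, Inp.map]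

lemma PCPrograph.isomorphic_iff {P : PCPrograph C Pr} {P' : PCPrograph C' Pr'} :
    P.Isomorphic P' ↔ ∃ κ : Port C Pr ≃ Port C' Pr', P.dual.map κ = P'.dual := by
  simp only [Triangulation.map_eq_iff]
  constructor
  · rintro ⟨f, g, hnext, hroot⟩
    refine ⟨.ofBijective _ (Port.bijective_map f g), Port.turn_map f g, ?_, ?_, ?_⟩
    · rintro (q | i)
      · exact congrArg Sum.inr (hnext q)
      · obtain ⟨q, rfl⟩ := P.next.surjective i
        simp [dual, ← hnext]
    · rintro (q | i) <;> simp [dual]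
    · simp [dual, hroot, ← hnext, Out.map]
  · rintro ⟨κ, hturn, hwire, hpos, hroot⟩
    obtain ⟨f, g, hκ⟩ := Port.exists_eq_map_equiv (κ := κ) hturn fun a ↦ Bool.eq_iff_iff.2 (hpos a)
    rw [hκ] at hwire hroot
    have hnext (q) : P'.next (q.map f g) = (P.next q).map f g := by
      simpa [dual] using hwire (.inl q)
    refine ⟨f, g, hnext, ?_⟩
    simpa [dual, ← hnext, Out.map] using hroot

end Isomorphisms

section Duality

variable {C Pr C' Pr' D D' D'' : Type u} {P : PCPrograph C Pr} {P' : PCPrograph C' Pr'}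
  {T : Triangulation D} {T' : Triangulation D'} {T'' : Triangulation D''}

/-- A dart-by-dart copy of the dual triangulation is dual to the prograph. -/
def Duality.ofMapEq {e : Port C Pr ≃ D} (h : P.dual.map e = T) : Duality P T where
  dart := e
  dart_turn a := ((Triangulation.map_eq_iff.1 h).1 a).symm
  dart_wire a := ((Triangulation.map_eq_iff.1 h).2.1 a).symm
  pos_out q := by simp [(Triangulation.map_eq_iff.1 h).2.2.1, PCPrograph.dual]
  pos_inp i := by simp [(Triangulation.map_eq_iff.1 h).2.2.1, PCPrograph.dual]
  dart_root := (Triangulation.map_eq_iff.1 h).2.2.2.symm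

lemma Duality.map_eq (δ : Duality P T) : P.dual.map δ.dart = T := by
  refine Triangulation.map_eq_iff.2 ⟨fun a ↦ (δ.dart_turn a).symm, fun a ↦ (δ.dart_wire a).symm, ?_,
    δ.dart_root.symm⟩
  rintro (q | i)
  · simp [δ.pos_out, PCPrograph.dual]
  · simp [δ.pos_inp, PCPrograph.dual]

lemma exists_duality (T : Triangulation D) :
    ∃ (C Pr : Type u) (P : PCPrograph C Pr), Nonempty (Duality P T) := by
  obtain ⟨C, Pr, e, P, hP⟩ := T.exists_map_eq_dual
  exact ⟨C, Pr, P, ⟨.ofMapEq (e := e.symm) (by simp [hP, Triangulation.map_map])⟩⟩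

lemma Triangulation.isomorphic_map_iff (e : D ≃ D') :
    (T.map e).Isomorphic T'' ↔ T.Isomorphic T'' := by
  simp only [Triangulation.isomorphic_iff, Triangulation.map_map]
  exact ⟨fun ⟨e', h⟩ ↦ ⟨e.trans e', h⟩,
    fun ⟨e', h⟩ ↦ ⟨e.symm.trans e', by simpa [← Equiv.trans_assoc] using h⟩⟩

lemma Triangulation.Isomorphic.symm (h : T.Isomorphic T') : T'.Isomorphic T := by
  obtain ⟨e, rfl⟩ := Triangulation.isomorphic_iff.1 h
  exact Triangulation.isomorphic_iff.2 ⟨e.symm, by simp [Triangulation.map_map]⟩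

lemma Duality.isomorphic_iff (δ : Duality P T) (δ' : Duality P' T') :
    P.Isomorphic P' ↔ T.Isomorphic T' := by
  rw [PCPrograph.isomorphic_iff, ← Triangulation.isomorphic_iff, ← δ.map_eq,
    Triangulation.isomorphic_map_iff, ← δ'.map_eq]
  exact ⟨fun h ↦ (Triangulation.isomorphic_map_iff _).2 h.symm |>.symm,
    fun h ↦ ((Triangulation.isomorphic_map_iff _).1 h.symm).symm⟩

end Duality

/-! ## Flips -/

section FlipFace

variable {D : Type u} {A : Type*} {f o f' : Equiv.Perm D} {d : D}

/-- `f'` is the face permutation after a flip at the edge of `d`, where `f` is the face permutation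
before the flip and `o` exchanges the two darts of each edge. The new diagonal keeps the darts of
the old one: `d` now closes the triangle that contains `f (f d)` and `f (o d)`. -/
structure FlipFace (f o : Equiv.Perm D) (d : D) (f' : Equiv.Perm D) : Prop where
  nodup : [d, f d, f (f d), o d, f (o d), f (f (o d))].Nodup
  left : f' d = f (f d) ∧ f' (f (f d)) = f (o d) ∧ f' (f (o d)) = d
  right : f' (o d) = f (f (o d)) ∧ f' (f (f (o d))) = f d ∧ f' (f d) = o d
  other : ∀ x ∉ [d, f d, f (f d), o d, f (o d), f (f (o d))], f' x = f x

namespace FlipFace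

lemma descend [DecidableEq D] (h : FlipFace f o d f') (hf : ∀ x, f (f (f x)) = x)
    (ho : Function.Involutive o) {F : D → A} (hF : ∀ x, F (o x) = F (f x)) (x : D) :
    let F' := Function.update (Function.update F d (F (f (f (o d))))) (o d) (F (f (f d)))
    F' (o x) = F' (f' x) := by
  obtain ⟨hnd, ⟨h₁, h₂, h₃⟩, ⟨h₄, h₅, h₆⟩, h₇⟩ := h
  have ho' : o x = d ↔ x = o d := ho.eq_iff
  simp only [Function.update_apply, o.injective.eq_iff, ho', hF]
  have hf' (y) : f x = y ↔ x = f (f y) := by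
    rw [← f.injective.eq_iff, ← f.injective.eq_iff, hf]
  by_cases hx : x ∈ [d, f d, f (f d), o d, f (o d), f (f (o d))]
  · simp only [List.nodup_cons, List.mem_cons, List.not_mem_nil, or_false, not_or] at hnd hx
    have := hf d
    have := hf (o d)
    have := hF d
    have := hF (o d)
    have := ho d
    rcases hx with rfl | rfl | rfl | rfl | rfl | rfl <;> grind
  · simp only [h₇ x hx, hf']
    simp only [List.mem_cons, List.not_mem_nil, or_false, not_or] at hx
    simp [hx]

lemma conj_swap [DecidableEq D] (h : FlipFace f o d f') (hf : ∀ x, f (f (f x)) = x) :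
    FlipFace f' o d (Equiv.swap d (o d) * f * Equiv.swap d (o d)) := by
  obtain ⟨hnd, ⟨h₁, h₂, -⟩, ⟨h₄, h₅, -⟩, h₇⟩ := h
  have hmem (x) : x ∈ [d, f' d, f' (f' d), o d, f' (o d), f' (f' (o d))] ↔
      x ∈ [d, f d, f (f d), o d, f (o d), f (f (o d))] := by
    simp only [h₁, h₂, h₄, h₅, List.mem_cons, List.not_mem_nil, or_false]
    tauto
  simp only [List.nodup_cons, List.mem_cons, List.not_mem_nil, or_false, not_or] at hnd
  have := hf d
  have := hf (o d)
  refine ⟨?_, ?_, ?_, fun x hx ↦ ?_⟩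
  · simp only [h₁, h₂, h₄, h₅, List.nodup_cons, List.mem_cons, List.not_mem_nil, or_false, not_or]
    grind
  · simp only [Equiv.Perm.mul_apply, Equiv.swap_apply_def]
    grind
  · simp only [Equiv.Perm.mul_apply, Equiv.swap_apply_def]
    grind
  · rw [hmem] at hx
    have hf' (y) : f x = y ↔ x = f (f y) := by
      rw [← f.injective.eq_iff, ← f.injective.eq_iff, hf]
    rw [h₇ x hx]
    simp only [List.mem_cons, List.not_mem_nil, or_false, not_or] at hx
    simp [Equiv.swap_apply_def, hf', hx]

lemma unique {f'' : Equiv.Perm D} (h : FlipFace f o d f') (h' : FlipFace f o d f'') :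
    f' = f'' := by
  ext x
  by_cases hx : x ∈ [d, f d, f (f d), o d, f (o d), f (f (o d))]
  · simp only [List.mem_cons, List.not_mem_nil, or_false] at hx
    have := h.left
    have := h.right
    have := h'.left
    have := h'.right
    rcases hx with rfl | rfl | rfl | rfl | rfl | rfl <;> simp only [*]
  · rw [h.other x hx, h'.other x hx]

lemma opp (h : FlipFace f o d f') (ho : Function.Involutive o) : FlipFace f o (o d) f' := by
  have hperm : [d, f d, f (f d), o d, f (o d), f (f (o d))].Perm
      [o d, f (o d), f (f (o d)), d, f d, f (f d)] :=
    List.perm_append_comm (l₁ := [d, f d, f (f d)])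
  refine ⟨?_, ?_, ?_, fun x hx ↦ h.other x ?_⟩
  · rw [ho]
    exact hperm.nodup h.nodup
  · simpa only [ho d] using h.right
  · simpa only [ho d] using h.left
  · rw [ho] at hx
    rwa [hperm.mem_iff]

lemma ascend [DecidableEq D] (h : FlipFace f o d f') (hf : ∀ x, f (f (f x)) = x)
    (ho : Function.Involutive o) {F : D → A} (hF : ∀ x, F (o x) = F (f' x)) (x : D) :
    let F' := Function.update (Function.update F d (F (f (o d)))) (o d) (F (f d))
    F' (o x) = F' (f x) := by
  obtain ⟨hnd, ⟨h₁, h₂, h₃⟩, ⟨h₄, h₅, h₆⟩, h₇⟩ := h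
  have ho' : o x = d ↔ x = o d := ho.eq_iff
  have hf' (y) : f x = y ↔ x = f (f y) := by
    rw [← f.injective.eq_iff, ← f.injective.eq_iff, hf]
  simp only [Function.update_apply, o.injective.eq_iff, ho', hF, hf']
  by_cases hx : x ∈ [d, f d, f (f d), o d, f (o d), f (f (o d))]
  · simp only [List.nodup_cons, List.mem_cons, List.not_mem_nil, or_false, not_or] at hnd hx
    have := hf d
    have := hf (o d)
    have := hF d
    have := hF (o d)
    have := ho d
    rcases hx with rfl | rfl | rfl | rfl | rfl | rfl <;> grind
  · rw [h₇ x hx]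
    simp only [List.mem_cons, List.not_mem_nil, or_false, not_or] at hx
    simp [hx]

lemma exists_vertexEquiv (h : FlipFace f o d f') (hf : ∀ x, f (f (f x)) = x)
    (ho : Function.Involutive o) :
    ∃ k : Orbit (vertexPerm f' o) ≃ Orbit (vertexPerm f o),
      (∀ x, x ≠ d → x ≠ o d → k (orbitOf _ x) = orbitOf _ x) ∧
      k (orbitOf _ d) = orbitOf _ (f (f (o d))) ∧ k (orbitOf _ (o d)) = orbitOf _ (f (f d)) := by
  classical
  have lift_iff {A : Type u} {φ : Equiv.Perm D} {F : D → A} (hF : ∀ x, F (o x) = F (φ x)) (x) :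
      F (vertexPerm φ o x) = F x := by
    obtain ⟨x, rfl⟩ := φ.surjective x
    rw [vertexPerm_apply_face, hF]
  let K := Function.update (Function.update (orbitOf (vertexPerm f o)) d
    (orbitOf _ (f (f (o d))))) (o d) (orbitOf _ (f (f d)))
  let L := Function.update (Function.update (orbitOf (vertexPerm f' o)) d
    (orbitOf _ (f (o d)))) (o d) (orbitOf _ (f d))
  have hK (x) : K (o x) = K (f' x) := h.descend hf ho orbitOf_vertexPerm_opp x
  have hL (x) : L (o x) = L (f x) := h.ascend hf ho orbitOf_vertexPerm_opp x
  have hne := h.nodup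
  simp only [List.nodup_cons, List.mem_cons, List.not_mem_nil, or_false, not_or] at hne
  have hKd : K d = orbitOf _ (f (f (o d))) := by simp [K, hne]
  have hKo : K (o d) = orbitOf _ (f (f d)) := by simp [K]
  have hKx (x) (hx : x ≠ d) (hx' : x ≠ o d) : K x = orbitOf _ x := by simp [K, hx, hx']
  have hLd : L d = orbitOf _ (f (o d)) := by simp [L, hne]
  have hLo : L (o d) = orbitOf _ (f d) := by simp [L]
  have hLx (x) (hx : x ≠ d) (hx' : x ≠ o d) : L x = orbitOf _ x := by simp [L, hx, hx']
  let k : Orbit (vertexPerm f' o) → Orbit (vertexPerm f o) := Orbit.lift K (lift_iff hK)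
  let l : Orbit (vertexPerm f o) → Orbit (vertexPerm f' o) := Orbit.lift L (lift_iff hL)
  have hk (x) : k (orbitOf _ x) = K x := rfl
  have hl (x) : l (orbitOf _ x) = L x := rfl
  refine ⟨⟨k, l, fun v ↦ ?_, fun v ↦ ?_⟩, hKx, hKd, hKo⟩ <;>
    induction v using Quotient.inductionOn with | h x
  · rw [hk]
    by_cases hx : x = d
    · rw [hx, hKd, hl, hLx _ (by grind) (by grind), ← h.right.1, ← orbitOf_vertexPerm_opp, ho]
    by_cases hx' : x = o d
    · rw [hx', hKo, hl, hLx _ (by grind) (by grind), ← h.left.1, ← orbitOf_vertexPerm_opp]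
    · rw [hKx x hx hx', hl, hLx x hx hx']
  · rw [hl]
    by_cases hx : x = d
    · rw [hx, hLd, hk, hKx _ (by grind) (by grind), ← orbitOf_vertexPerm_opp, ho]
    by_cases hx' : x = o d
    · rw [hx', hLo, hk, hKx _ (by grind) (by grind), ← orbitOf_vertexPerm_opp]
    · rw [hLx x hx hx', hk, hKx x hx hx']

lemma isSphereMap (h : FlipFace f o d f') (hf : ∀ x, f (f (f x)) = x)
    (ho : Function.Involutive o) (hcount : orbitCount f' = orbitCount f) (hs : IsSphereMap f o) :
    IsSphereMap f' o := by
  refine ⟨?_, ?_⟩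
  · have hs₁ := hs.1
    rw [transitive_iff_forall_invariant] at hs₁ ⊢
    intro p hp
    have hf' (x) : p (f' x) = p x := hp f' (by simp) x
    have ho' (x) : p (o x) = p x := hp o (by simp) x
    have hinv (x) : p (f x) = p x := by
      by_cases hx : x ∈ [d, f d, f (f d), o d, f (o d), f (f (o d))]
      · have h₁ := hf' d
        have h₂ := hf' (f (f d))
        have h₃ := hf' (o d)
        have h₄ := hf' (f (f (o d)))
        rw [h.left.1] at h₁
        rw [h.left.2.1] at h₂
        rw [h.right.1] at h₃
        rw [h.right.2.1] at h₄
        simp only [List.mem_cons, List.not_mem_nil, or_false] at hx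
        rcases hx with rfl | rfl | rfl | rfl | rfl | rfl <;> simp only [*]
      · rw [← h.other x hx, hf']
    refine hs₁ p ?_
    simp only [Set.mem_insert_iff, Set.mem_singleton_iff, forall_eq_or_imp, forall_eq]
    exact ⟨hinv, ho'⟩
  · obtain ⟨k, -⟩ := h.exists_vertexEquiv hf ho
    have hk : orbitCount (o * f'⁻¹) = orbitCount (o * f⁻¹) := Nat.card_congr k
    rw [hcount, hk]
    exact hs.2

end FlipFace

end FlipFace

section Flips

variable {D D' D'' : Type u}

lemma FlipFace.map {f o f' : Equiv.Perm D} {d : D} (h : FlipFace f o d f') (e : D ≃ D') :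
    FlipFace (e.permCongr f) (e.permCongr o) (e d) (e.permCongr f') := by
  refine ⟨by simpa using h.nodup, by simpa using h.left, by simpa using h.right, fun x hx ↦ ?_⟩
  obtain ⟨x, rfl⟩ := e.surjective x
  simpa using h.other x (by simpa using hx)

namespace Triangulation

variable {T T' T'' : Triangulation D} {d : D}

lemma origin_face_ne (d : D) : T.origin (T.face d) ≠ T.origin d := fun h ↦ by
  by_cases hd : T.pos d
  · exact T.acyclic_adj _ (.single (h ▸ adj_of_pos hd))
  · exact T.acyclic_adj _ (.single (h ▸ adj_of_neg hd))

/-- `T'` is obtained from `T` by a valid flip of the edge of `d`, the two darts of the old diagonal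
being those of the new one. Every valid flip has this form, up to isomorphism (`flip_iff`). -/
structure IsFlip (T : Triangulation D) (d : D) (T' : Triangulation D) : Prop where
  ne_root : d ≠ T.root
  ne_opp_root : d ≠ T.opp T.root
  face : FlipFace T.face T.opp d T'.face
  opp : T'.opp = T.opp
  root : T'.root = T.root
  pos_iff : ∀ x, x ≠ d → x ≠ T.opp d → (T'.pos x ↔ T.pos x)

namespace IsFlip

lemma nodup_origin (h : T.IsFlip d T') :
    [T.origin d, T.origin (T.opp d), T.origin (T.face (T.face d)),
      T.origin (T.face (T.face (T.opp d)))].Nodup := by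
  obtain ⟨k, -, hd, hd'⟩ := h.face.exists_vertexEquiv T.face_face_face T.opp_opp
  have hdiag : T.origin (T.face (T.face d)) ≠ T.origin (T.face (T.face (T.opp d))) := fun heq ↦ by
    have hk : orbitOf (vertexPerm T'.face T.opp) (T.opp d) = orbitOf _ d :=
      k.injective (hd'.trans (heq.trans hd.symm))
    rw [← h.opp] at hk
    exact T'.origin_face_ne d ((T'.origin_opp d).symm.trans hk)
  have h₁ := T.origin_face_ne d
  have h₂ := T.origin_face_ne (T.face d)
  have h₃ := T.origin_face_ne (T.face (T.face d))
  have h₄ := T.origin_face_ne (T.face (T.opp d))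
  have h₅ := T.origin_face_ne (T.face (T.face (T.opp d)))
  have h₆ := T.origin_opp (T.opp d)
  rw [T.face_face_face] at h₃ h₅
  rw [T.opp_opp] at h₆
  rw [← T.origin_opp] at h₁
  rw [← T.origin_opp d] at h₂
  simp only [List.nodup_cons, List.mem_cons, List.not_mem_nil, or_false, not_or,
    not_false_eq_true, List.nodup_nil, and_true]
  exact ⟨⟨h₁.symm, h₃, h₆ ▸ h₄.symm⟩, ⟨h₂.symm, h₅⟩, hdiag⟩

protected lemma opp_dart (h : T.IsFlip d T') : T.IsFlip (T.opp d) T' where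
  ne_root hd := h.ne_opp_root (by rw [← hd, T.opp_opp])
  ne_opp_root hd := h.ne_root (T.opp.injective hd)
  face := h.face.opp T.opp_opp
  opp := h.opp
  root := h.root
  pos_iff x hx hx' := h.pos_iff x (by rwa [T.opp_opp] at hx') hx

protected lemma map (h : T.IsFlip d T') (e : D ≃ D') : (T.map e).IsFlip (e d) (T'.map e) where
  ne_root := by simpa using h.ne_root
  ne_opp_root := by simpa using h.ne_opp_root
  face := h.face.map e
  opp := by simp only [Triangulation.map, h.opp]
  root := by simp [h.root]
  pos_iff x := by
    obtain ⟨x, rfl⟩ := e.surjective x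
    simpa using h.pos_iff x

protected lemma symm [DecidableEq D] (h : T.IsFlip d T') :
    T'.IsFlip d (T.map (Equiv.swap d (T.opp d))) where
  ne_root := h.root ▸ h.ne_root
  ne_opp_root := h.root ▸ h.opp ▸ h.ne_opp_root
  face := by
    rw [h.opp]
    convert h.face.conj_swap T.face_face_face using 1
    ext x
    simp [Triangulation.map]
  opp := Equiv.ext fun x ↦ by
    obtain ⟨x, rfl⟩ := (Equiv.swap d (T.opp d)).surjective x
    rw [map_opp_apply, h.opp]
    by_cases hx : x = d
    · simp [hx, T.opp_opp]
    by_cases hx' : x = T.opp d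
    · simp [hx', T.opp_opp]
    have hox : T.opp x ≠ d := fun hd ↦ hx' (by rw [← hd, T.opp_opp])
    rw [Equiv.swap_apply_of_ne_of_ne hx hx',
      Equiv.swap_apply_of_ne_of_ne hox (T.opp.injective.ne hx)]
  root := by
    have hne : T.root ≠ T.opp d := fun hd ↦ h.ne_opp_root (by rw [hd, T.opp_opp])
    rw [map_root, Equiv.swap_apply_of_ne_of_ne h.ne_root.symm hne, h.root]
  pos_iff x hx hx' := by
    rw [h.opp] at hx'
    rw [h.pos_iff x hx hx', ← T.map_pos_apply (Equiv.swap d (T.opp d)),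
      Equiv.swap_apply_of_ne_of_ne hx hx']

lemma unique (h : T.IsFlip d T') (h' : T.IsFlip d T'') (hd : T'.pos d ↔ T''.pos d) : T' = T'' := by
  refine ext (h.face.unique h'.face) (h.opp.trans h'.opp.symm) (fun x ↦ ?_)
    (h.root.trans h'.root.symm)
  by_cases hx : x = d
  · rw [hx, hd]
  by_cases hx' : x = T.opp d
  · rw [hx']
    nth_rewrite 1 [← h.opp]
    rw [← h'.opp, T'.pos_opp, T''.pos_opp, hd]
  · rw [h.pos_iff x hx hx', h'.pos_iff x hx hx']

lemma pos_diagonal_iff (h : T.IsFlip d T')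
    (hpos : T.pos (T.face (T.face d)) ↔ T.pos (T.face (T.opp d))) :
    T'.pos d ↔ ¬ T.pos (T.face (T.face d)) := by
  have hne := h.face.nodup
  simp only [List.nodup_cons, List.mem_cons, List.not_mem_nil, or_false, not_or] at hne
  have hb := h.pos_iff (T.face (T.face d)) (by tauto) (by tauto)
  have ha := h.pos_iff (T.face (T.opp d)) (Ne.symm (by tauto)) (Ne.symm (by tauto))
  have hneg := T'.exists_neg_of_triangle d
  have hpos' := T'.exists_pos_of_triangle d
  rw [h.face.left.1, h.face.left.2.1, hb, ha, hpos] at hneg hpos'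
  rw [hpos]
  tauto

end IsFlip

lemma nodup_of_nodup_origin (h : [T.origin d, T.origin (T.opp d), T.origin (T.face (T.face d)),
      T.origin (T.face (T.face (T.opp d)))].Nodup) :
    [d, T.face d, T.face (T.face d), T.opp d, T.face (T.opp d),
      T.face (T.face (T.opp d))].Nodup := by
  have h₁ := T.origin_opp d
  have h₂ := T.origin_opp (T.opp d)
  rw [T.opp_opp] at h₂
  have h₃ := T.face_face_face d
  have h₄ := T.face_face_face (T.opp d)
  simp only [List.nodup_cons, List.mem_cons, List.not_mem_nil, or_false, not_or,
    not_false_eq_true, List.nodup_nil, and_true] at h ⊢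
  and_intros <;> grind

/-- The triangulations with a distinguished edge `(T, d)` and `(T', d')` are isomorphic. -/
def EdgeIsomorphic (T : Triangulation D) (d : D) (T' : Triangulation D') (d' : D') : Prop :=
  ∃ e : D ≃ D', T.map e = T' ∧ (d' = e d ∨ d' = e (T.opp d))

namespace EdgeIsomorphic

variable {T' : Triangulation D'} {T'' : Triangulation D''} {d' : D'} {d'' : D''}

protected lemma symm (h : EdgeIsomorphic T d T' d') : EdgeIsomorphic T' d' T d := by
  obtain ⟨e, rfl, rfl | rfl⟩ := h
  · exact ⟨e.symm, by simp [map_map], by simp⟩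
  · exact ⟨e.symm, by simp [map_map], by simp [T.opp_opp]⟩

protected lemma trans (h : EdgeIsomorphic T d T' d') (h' : EdgeIsomorphic T' d' T'' d'') :
    EdgeIsomorphic T d T'' d'' := by
  obtain ⟨e, rfl, hd⟩ := h
  obtain ⟨e', rfl, hd'⟩ := h'
  refine ⟨e.trans e', (map_map ..).symm, ?_⟩
  rcases hd with rfl | rfl <;> rcases hd' with rfl | rfl <;> simp [T.opp_opp]

end EdgeIsomorphic

lemma flip_iff {T' : Triangulation D'} {d' : D'} :
    Flip T d T' d' ↔ ∃ T₁, T.IsFlip d T₁ ∧ EdgeIsomorphic T₁ d T' d' := by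
  constructor
  · rintro ⟨hd, hd', hnd, g, hg, hopp, hroot, hpos, h₁, h₂, h₃, h₄, h₅, h₆, hface⟩
    have hopp' : (T'.map g.symm).opp = T.opp := Equiv.ext fun x ↦ by simp [map, hopp]
    refine ⟨T'.map g.symm, ⟨hd, hd', ⟨nodup_of_nodup_origin hnd, ?_, ?_, fun x hx ↦ ?_⟩, hopp', ?_,
      fun x hx hx' ↦ ?_⟩, g, by simp [map_map], by rwa [hopp']⟩
    · simp [map, h₁, h₂, h₃]
    · simp [map, h₄, h₅, h₆]
    · simp only [List.mem_cons, List.not_mem_nil, or_false, not_or] at hx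
      obtain ⟨hx₁, hx₂, hx₃, hx₄, hx₅, hx₆⟩ := hx
      simp [map, hface x hx₁ hx₂ hx₃ hx₄ hx₅ hx₆]
    · simp [hroot]
    · simpa [map] using hpos x hx hx'
  · rintro ⟨T₁, h, g, rfl, hg⟩
    rw [h.opp] at hg
    refine ⟨by simpa [h.root] using h.ne_root, h.ne_opp_root, h.nodup_origin, g, hg, ?_⟩
    simp only [map_face_apply, map_opp_apply, map_pos_apply, map_root, h.opp, h.root]
    exact ⟨fun _ ↦ trivial, trivial, h.pos_iff,
      congrArg g h.face.left.1, congrArg g h.face.left.2.1, congrArg g h.face.left.2.2,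
      congrArg g h.face.right.1, congrArg g h.face.right.2.1, congrArg g h.face.right.2.2,
      fun x h₁ h₂ h₃ h₄ h₅ h₆ ↦ congrArg g (h.face.other x (by simp [*]))⟩

end Triangulation

namespace Flip

open Triangulation

variable {D₁ D₂ D₃ : Type u} {T : Triangulation D} {T₁ : Triangulation D₁} {T₂ : Triangulation D₂}
  {T₃ : Triangulation D₃} {d : D} {d₁ : D₁} {d₂ : D₂} {d₃ : D₃}

protected lemma symm (h : Flip T d T₁ d₁) : Flip T₁ d₁ T d := by
  classical
  obtain ⟨T', hflip, e, rfl, hd⟩ := flip_iff.1 h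
  refine flip_iff.2 ⟨(T.map (Equiv.swap d (T.opp d))).map e, ?_, ?_⟩
  · rcases hd with rfl | rfl
    · exact hflip.symm.map e
    · simpa [hflip.opp] using (hflip.symm.map e).opp_dart
  · rw [map_map]
    refine EdgeIsomorphic.symm ⟨_, rfl, ?_⟩
    rw [hflip.opp] at hd
    simpa [or_comm] using hd

lemma trans_edgeIsomorphic (h : Flip T d T₁ d₁) (h' : EdgeIsomorphic T₁ d₁ T₂ d₂) :
    Flip T d T₂ d₂ := by
  obtain ⟨T', h, hiso⟩ := flip_iff.1 h
  exact flip_iff.2 ⟨T', h, hiso.trans h'⟩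

lemma edgeIsomorphic_of_pos_iff (h₁ : Flip T d T₁ d₁) (h₂ : Flip T d T₂ d₂)
    (hpos : (T.pos (T.face (T.face d)) ↔ T.pos (T.face (T.opp d))) ∨
      (T.pos (T.face (T.face (T.opp d))) ↔ T.pos (T.face d))) :
    EdgeIsomorphic T₁ d₁ T₂ d₂ := by
  obtain ⟨T', h', hiso'⟩ := flip_iff.1 h₁
  obtain ⟨T'', h'', hiso''⟩ := flip_iff.1 h₂
  have heq : T' = T'' := by
    rcases hpos with hpos | hpos
    · exact h'.unique h'' ((h'.pos_diagonal_iff hpos).trans (h''.pos_diagonal_iff hpos).symm)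
    · rw [← T.opp_opp d] at hpos
      nth_rewrite 1 [T.opp_opp d] at hpos
      exact h'.opp_dart.unique h''.opp_dart
        ((h'.opp_dart.pos_diagonal_iff hpos).trans (h''.opp_dart.pos_diagonal_iff hpos).symm)
  exact hiso'.symm.trans (heq ▸ hiso'')

lemma edgeIsomorphic_or (h₁ : Flip T d T₁ d₁) (h₂ : Flip T d T₂ d₂) (h₃ : Flip T d T₃ d₃) :
    EdgeIsomorphic T₁ d₁ T₂ d₂ ∨ EdgeIsomorphic T₁ d₁ T₃ d₃ ∨ EdgeIsomorphic T₂ d₂ T₃ d₃ := by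
  obtain ⟨T₁', h₁, hiso₁⟩ := flip_iff.1 h₁
  obtain ⟨T₂', h₂, hiso₂⟩ := flip_iff.1 h₂
  obtain ⟨T₃', h₃, hiso₃⟩ := flip_iff.1 h₃
  -- The new diagonal has only two orientations.
  by_cases h₁₂ : T₁'.pos d ↔ T₂'.pos d
  · exact .inl (hiso₁.symm.trans (h₁.unique h₂ h₁₂ ▸ hiso₂))
  by_cases h₁₃ : T₁'.pos d ↔ T₃'.pos d
  · exact .inr (.inl (hiso₁.symm.trans (h₁.unique h₃ h₁₃ ▸ hiso₃)))
  · exact .inr (.inr (hiso₂.symm.trans (h₂.unique h₃ (by tauto) ▸ hiso₃)))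

end Flip

end Flips

/-! ## Merging two adjacent operators -/

section Contraction

-- A vertex is ranked by the number of its predecessors once `a` and `b` are identified.
lemma exists_strictMono_eq_of_acyclic {X : Type*} {R : X → X → Prop} [Finite X] {a b : X}
    (h : ∀ x, ¬ Relation.TransGen R x x) (hab : ¬ Relation.TransGen R a b)
    (hba : ¬ Relation.TransGen R b a) :
    ∃ rank : X → ℕ, rank a = rank b ∧ ∀ x y, R x y → rank x < rank y := by
  let pred (x : X) : Set X := {w | Relation.TransGen R w x ∨
    (Relation.ReflTransGen R a x ∨ Relation.ReflTransGen R b x) ∧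
      (Relation.TransGen R w a ∨ Relation.TransGen R w b)}
  have pred_self (x) : x ∉ pred x := by
    rintro (hx | ⟨hx | hx, hx' | hx'⟩)
    exacts [h _ hx, h _ (hx'.trans_left hx), hab (hx'.trans_right hx), hba (hx'.trans_right hx),
      h _ (hx'.trans_left hx)]
  refine ⟨fun x ↦ (pred x).ncard, congrArg Set.ncard (Set.ext fun w ↦ ?_), fun x y hxy ↦ ?_⟩
  · simp only [pred, Set.mem_ofPred_eq, Relation.ReflTransGen.refl, true_or, or_true, true_and]
    tauto
  · have hle : pred x ⊆ pred y := by
      rintro w (hw | ⟨hx, hw⟩)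
      exacts [.inl (hw.tail hxy), .inr ⟨hx.imp (·.tail hxy) (·.tail hxy), hw⟩]
    exact Set.ncard_lt_ncard (hle.ssubset_of_mem_notMem (.inl (.single hxy)) (pred_self x))
      (Set.toFinite _)

end Contraction

namespace Triangulation

variable {D : Type u} {T : Triangulation D} {d : D}

lemma face_ne_opp (d : D) : T.face d ≠ T.opp d := fun h ↦ by
  have hne := T.origin_face_ne (T.face (T.face d))
  rw [T.face_face_face, h, ← T.origin_opp, T.opp_opp] at hne
  exact hne rfl

lemma face_face_ne_opp (d : D) : T.face (T.face d) ≠ T.opp d := fun h ↦ by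
  refine T.face_ne_opp (T.opp d) ?_
  rw [T.opp_opp, ← h, T.face_face_face]

lemma exists_pos_to_ne (h : T.pos (T.face (T.face d)) ∨ ¬ T.pos (T.face (T.opp d)))
    {v : T.Vertex} (hv : v ≠ T.origin T.root) :
    ∃ x, T.pos x ∧ x ≠ T.opp d ∧ T.origin (T.opp x) = v := by
  obtain ⟨w, x, hx, -, rfl⟩ := exists_adj_of_ne_source hv
  by_cases hxd : x = T.opp d
  swap
  · exact ⟨x, hx, hxd, rfl⟩
  rw [hxd]
  rcases h with h | h
  · exact ⟨_, h, T.face_face_ne_opp d, by rw [T.origin_opp, T.face_face_face, T.opp_opp]⟩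
  · refine ⟨T.opp (T.face (T.opp d)), (T.pos_opp _).2 h, fun hne ↦ ?_, ?_⟩
    · exact T.face_ne_opp (T.opp d) (by rw [T.opp.injective hne, T.opp_opp])
    · rw [T.opp_opp, ← T.origin_opp]

lemma exists_pos_from_ne (h : T.pos (T.face d) ∨ ¬ T.pos (T.face (T.face (T.opp d))))
    {v : T.Vertex} (hv : v ≠ T.origin (T.opp T.root)) :
    ∃ x, T.pos x ∧ x ≠ T.opp d ∧ T.origin x = v := by
  obtain ⟨w, x, hx, rfl, -⟩ := exists_adj_of_ne_sink hv
  by_cases hxd : x = T.opp d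
  swap
  · exact ⟨x, hx, hxd, rfl⟩
  rw [hxd]
  rcases h with h | h
  · exact ⟨_, h, T.face_ne_opp d, (T.origin_opp d).symm⟩
  · refine ⟨T.opp (T.face (T.face (T.opp d))), (T.pos_opp _).2 h, fun hne ↦ ?_, ?_⟩
    · exact T.face_face_ne_opp (T.opp d) (by rw [T.opp.injective hne, T.opp_opp])
    · rw [T.origin_opp, T.face_face_face]

end Triangulation

namespace PCPrograph

variable {C Pr : Type u} {P : PCPrograph C Pr} {e : Out C Pr}

lemma pos_or_of_edgeType_ne_II (h : P.edgeType e ≠ .II) :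
    P.dual.pos (P.dual.face (P.dual.face (.inl e))) ∨
      ¬ P.dual.pos (P.dual.face (P.dual.opp (.inl e))) := by
  unfold edgeType at h
  rcases e with c | c | p <;> rcases hj : P.next _ with c' | p' | p' <;> rw [hj] at h <;>
    simp_all [dual, Port.turn]

lemma pos_or_of_edgeType_ne_VI (h : P.edgeType e ≠ .VI) :
    P.dual.pos (P.dual.face (.inl e)) ∨
      ¬ P.dual.pos (P.dual.face (P.dual.face (P.dual.opp (.inl e)))) := by
  unfold edgeType at h
  rcases e with c | c | p <;> rcases hj : P.next _ with c' | p' | p' <;> rw [hj] at h <;>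
    simp_all [dual, Port.turn]

/-- The relation on the operators given by the non-virtual edges other than `e`. -/
def ArcNe (P : PCPrograph C Pr) (e : Out C Pr) (a b : C ⊕ Pr) : Prop :=
  ∃ q : Out C Pr, q ≠ .prod P.root ∧ q ≠ e ∧ q.owner = a ∧ (P.next q).owner = b

lemma exists_potential_of_transGen_arcNe (he : e ≠ .prod P.root)
    (h : Relation.TransGen (P.ArcNe e) e.owner (P.next e).owner) :
    ∃ G : P.dual.Vertex → ℚ,
      G (P.dual.origin P.dual.root) = G (P.dual.origin (P.dual.opp P.dual.root)) ∧
      (∀ x, P.dual.pos x → x ≠ P.dual.opp (.inl e) →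
        G (P.dual.origin x) ≤ G (P.dual.origin (P.dual.opp x))) ∧ ∃ v w, G v ≠ G w := by
  have := P.finite_cop
  have := P.finite_prod
  let p : Port C Pr → Prop := Sum.elim (fun q ↦ q ≠ .prod P.root ∧ q ≠ e) (fun i ↦ i = P.next e)
  have hp : ∀ a, p a → ¬ p (Port.wire P.next a) := by
    rintro (q | i) ha
    · simpa [p] using ha.2
    · simp only [p, Sum.elim_inr] at ha
      simp [p, ha]
  have hcycle : Relation.TransGen (fun o o' ↦ ∃ a, p a ∧ Port.owner a = o ∧
      Port.owner (Port.wire P.next a) = o') e.owner e.owner := by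
    refine .tail (h.lift id ?_) ⟨.inr (P.next e), rfl, rfl, by simp [Port.owner]⟩
    rintro _ _ ⟨q, hq, hqe, rfl, rfl⟩
    exact ⟨.inl q, ⟨hq, hqe⟩, rfl, rfl⟩
  obtain ⟨g, hg, hle, heq, a, -, hlt⟩ := P.planar.exists_potential_of_face_cycle
    (Port.wire_wire P.next) (fun _ _ ↦ Port.sameCycle_turn) hp hcycle
  obtain ⟨G, rfl⟩ := (Function.factorsThrough_iff (g := g) (f := P.dual.origin)).1
    fun x y hxy ↦ P.dual.eq_of_origin_eq hg hxy
  have hroot : G (P.dual.origin P.dual.root) = G (P.dual.origin (P.dual.opp P.dual.root)) := by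
    refine (heq P.dual.root ?_ ?_).symm <;> simp [p, dual, he.symm]
  refine ⟨G, hroot, fun x hx hxe ↦ ?_, _, _, hlt.ne⟩
  rcases x with q | i
  · simp [dual] at hx
  obtain ⟨q, rfl⟩ := P.next.surjective i
  by_cases hq : q = .prod P.root
  · subst hq
    exact hroot.le
  · have hqe : q ≠ e := by
      rintro rfl
      exact hxe rfl
    have hopp : P.dual.opp (.inr (P.next q)) = .inl q := by simp [dual]
    rw [hopp]
    exact hle (.inl q) ⟨hq, hqe⟩

-- The faces have a unique source and a unique sink even without the dual of `e`, so that a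
-- potential of a cycle through the reversal of `e` is constant.
lemma not_transGen_arcNe (he : e ≠ .prod P.root) (hII : P.edgeType e ≠ .II)
    (hVI : P.edgeType e ≠ .VI) :
    ¬ Relation.TransGen (P.ArcNe e) e.owner (P.next e).owner := by
  intro h
  obtain ⟨G, hroot, hle, v, w, hvw⟩ := exists_potential_of_transGen_arcNe he h
  let R (v w : P.dual.Vertex) : Prop :=
    ∃ x, (P.dual.pos x ∧ x ≠ P.dual.opp (.inl e)) ∧ P.dual.origin x = v ∧
      P.dual.origin (P.dual.opp x) = w
  have hR : ∀ v, ¬ Relation.TransGen R v v := fun v hv ↦ P.dual.acyclic_adj v <| hv.lift id <| by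
    rintro _ _ ⟨x, hx, rfl, rfl⟩
    exact ⟨x, hx.1, rfl, rfl⟩
  refine hvw (neg_injective (eq_of_antitone_of_acyclic hR (fun v hv ↦ ?_) (fun v hv ↦ ?_)
    (f := fun v ↦ -G v) ?_ (neg_le_neg hroot.ge) v w))
  · obtain ⟨x, hx, hxe, h⟩ := Triangulation.exists_pos_to_ne (pos_or_of_edgeType_ne_II hII) hv
    exact ⟨_, x, ⟨hx, hxe⟩, rfl, h⟩
  · obtain ⟨x, hx, hxe, h⟩ := Triangulation.exists_pos_from_ne (pos_or_of_edgeType_ne_VI hVI) hv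
    exact ⟨_, x, ⟨hx, hxe⟩, h, rfl⟩
  · rintro _ _ ⟨x, ⟨hx, hxe⟩, rfl, rfl⟩
    exact neg_le_neg (hle x hx hxe)

lemma exists_rank_eq (he : e ≠ .prod P.root) (hII : P.edgeType e ≠ .II)
    (hVI : P.edgeType e ≠ .VI) :
    ∃ rank : C ⊕ Pr → ℕ, rank e.owner = rank (P.next e).owner ∧
      ∀ q, q ≠ .prod P.root → q ≠ e → rank q.owner < rank (P.next q).owner := by
  have := P.finite_cop
  have := P.finite_prod
  have hle : P.ArcNe e ≤ P.Arc := by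
    rintro _ _ ⟨q, hq, -, rfl, rfl⟩
    exact arc_of_ne hq
  obtain ⟨rank, heq, hlt⟩ := exists_strictMono_eq_of_acyclic
    (fun o ho ↦ P.acyclic o (Relation.TransGen.mono hle _ _ ho)) (not_transGen_arcNe he hII hVI)
    (fun h ↦ P.acyclic _ (.tail (Relation.TransGen.mono hle _ _ h) (arc_of_ne he)))
  exact ⟨rank, heq, fun q hq hqe ↦ hlt _ _ ⟨q, hq, hqe, rfl, rfl⟩⟩

end PCPrograph

/-! ## Rotations -/

section Relabellings

variable {C Pr : Type u} {r : Rule} {e e' : Out C Pr} {j j' : Inp C Pr}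
  {ψ : Equiv.Perm (Port C Pr)}

open Classical in
/-- The relabelling `ψ` of the ports replaces two adjacent operators by two others, the edge from
`e` to `j` becoming the edge from `e'` to `j'`, in such a way that the dual edge is flipped. -/
structure IsRelabelling (e : Out C Pr) (j : Inp C Pr) (e' : Out C Pr) (j' : Inp C Pr)
    (ψ : Equiv.Perm (Port C Pr)) : Prop where
  edge : ψ (.inl e) = .inl e' ∧ ψ (.inr j) = .inr j' ∨ ψ (.inl e) = .inr j' ∧ ψ (.inr j) = .inl e'
  isRight_apply : ∀ a, a ≠ .inl e → a ≠ .inr j → (ψ a).isRight = a.isRight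
  owner : s(e.owner, j.owner) = s(e'.owner, j'.owner)
  owner_apply : ∀ (F : C ⊕ Pr → ℕ), F e.owner = F j.owner →
    ∀ a, F (Port.owner (ψ a)) = F (Port.owner a)
  prod_apply : ∀ p, .prod p ≠ e → .prod p ≠ e' → ψ (.inl (.prod p)) = .inl (.prod p)
  cop_apply : ∀ c, .cop c ≠ j → .cop c ≠ j' → ψ (.inr (.cop c)) = .inr (.cop c)
  flipFace : FlipFace (Port.turn C Pr) (Equiv.swap (.inl e) (.inr j)) (.inl e)
    (ψ⁻¹ * Port.turn C Pr * ψ)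

open Classical in
/-- A rotation rule as a relabelling of the ports: the edge from `e` to `j` becomes the edge from
`e'` to `j'`, and the end of an edge at the port `a` moves to the port `ψ a`. -/
inductive Rule.Relabels :
    Rule → Out C Pr → Inp C Pr → Out C Pr → Inp C Pr → Equiv.Perm (Port C Pr) → Prop
  | IVtoI (x y : C) (h : x ≠ y) : Relabels .IVtoI (.right x) (.cop y) (.left x) (.cop y)
      [.inl (.right x), .inl (.left x), .inl (.left y), .inl (.right y)].formPerm
  | VIIItoIX (y z : Pr) (h : y ≠ z) : Relabels .VIIItoIX (.prod z) (.left y) (.prod z) (.right y)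
      [.inr (.left y), .inr (.right y), .inr (.right z), .inr (.left z)].formPerm
  | IIItoVII (x : C) (y : Pr) : Relabels .IIItoVII (.left x) (.right y) (.prod y) (.cop x)
      [.inr (.right y), .inl (.prod y), .inl (.left x), .inr (.cop x)].formPerm
  | VIItoV (x : C) (y : Pr) : Relabels .VIItoV (.prod y) (.cop x) (.right x) (.left y)
      [.inr (.cop x), .inl (.right x), .inl (.prod y), .inr (.left y)].formPerm

open Classical in
lemma Rule.Relabels.flipFace (h : r.Relabels e j e' j' ψ) : FlipFace (Port.turn C Pr)
    (Equiv.swap (.inl e) (.inr j)) (.inl e) (ψ⁻¹ * Port.turn C Pr * ψ) := by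
  refine ⟨?_, ?_, ?_, fun a ha ↦ ?_⟩ <;>
    simp only [Equiv.swap_apply_left, Equiv.Perm.mul_apply, Equiv.Perm.inv_eq_iff_eq] at *
  · cases h <;> simp [Port.turn, *]
    grind
  · cases h <;> simp [Port.turn, Equiv.swap_apply_def, *]
    grind
  · cases h <;> simp [Port.turn, Equiv.swap_apply_def, *]
    grind
  · have hfix {a : Port C Pr} (ha : a ∉ [.inl e, Port.turn C Pr (.inl e),
        Port.turn C Pr (Port.turn C Pr (.inl e)), .inr j, Port.turn C Pr (.inr j),
        Port.turn C Pr (Port.turn C Pr (.inr j))]) : ψ a = a := by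
      cases h <;> refine List.formPerm_apply_of_notMem fun h ↦ ha ?_ <;>
        simp [Port.turn] at h ⊢ <;> tauto
    rw [hfix ha, hfix]
    simp only [List.mem_cons] at ha ⊢
    grind [Port.turn_turn_turn]

lemma Rule.Relabels.isRelabelling (h : r.Relabels e j e' j' ψ) :
    IsRelabelling e j e' j' ψ where
  edge := by cases h <;> simp [Equiv.swap_apply_def, *]
  isRight_apply a hout hinp := by
    cases h <;> rcases a with ((c | c | p) | (c | p | p)) <;>
      simp [Equiv.swap_apply_def] <;> grind
  owner := by cases h <;> simp [Out.owner, Inp.owner]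
  owner_apply F hF a := by
    cases h <;> rcases a with ((c | c | p) | (c | p | p)) <;>
      simp [Equiv.swap_apply_def, Port.owner, Out.owner, Inp.owner] at hF ⊢ <;>
      grind [Out.owner, Inp.owner]
  prod_apply p he he' := by cases h <;> simp_all [Equiv.swap_apply_def]
  cop_apply c hj hj' := by cases h <;> simp_all [Equiv.swap_apply_def]
  flipFace := h.flipFace

namespace IsRelabelling

open Classical in
protected lemma symm (h : IsRelabelling e j e' j' ψ) :
    IsRelabelling e' j' e j (Equiv.swap (.inl e) (.inr j) * ψ⁻¹) where
  edge := by
    rcases h.edge with ⟨h₁, h₂⟩ | ⟨h₁, h₂⟩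
    · right; simp [← h₁, ← h₂]
    · left; simp [← h₁, ← h₂]
  isRight_apply a hout hinp := by
    obtain ⟨a, rfl⟩ := ψ.surjective a
    have ha₁ : a ≠ .inl e := by rintro rfl; rcases h.edge with h | h <;> simp_all
    have ha₂ : a ≠ .inr j := by rintro rfl; rcases h.edge with h | h <;> simp_all
    simp [Equiv.swap_apply_of_ne_of_ne ha₁ ha₂, h.isRight_apply a ha₁ ha₂]
  owner := h.owner.symm
  owner_apply F hF a := by
    obtain ⟨a, rfl⟩ := ψ.surjective a
    have hF' : F e.owner = F j.owner := by
      rcases Sym2.eq_iff.1 h.owner with ⟨h₁, h₂⟩ | ⟨h₁, h₂⟩ <;> simp [h₁, h₂, hF]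
    rw [h.owner_apply F hF']
    rcases eq_or_ne a (.inl e) with rfl | ha₁
    · simpa [Port.owner] using hF'.symm
    rcases eq_or_ne a (.inr j) with rfl | ha₂
    · simpa [Port.owner] using hF'
    simp [Equiv.swap_apply_of_ne_of_ne ha₁ ha₂]
  prod_apply p he he' := by
    rw [Equiv.Perm.mul_apply, Equiv.Perm.inv_eq_iff_eq.2 (h.prod_apply p he' he).symm,
      Equiv.swap_apply_of_ne_of_ne (by simpa using he') (by simp)]
  cop_apply c hj hj' := by
    rw [Equiv.Perm.mul_apply, Equiv.Perm.inv_eq_iff_eq.2 (h.cop_apply c hj' hj).symm,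
      Equiv.swap_apply_of_ne_of_ne (by simp) (by simpa using hj')]
  flipFace := by
    have hflip := (h.flipFace.conj_swap Port.turn_turn_turn).map ψ
    rw [Equiv.swap_apply_left] at hflip
    simp only [Equiv.permCongr_eq_mul, ← Equiv.swap_apply_apply] at hflip
    have hturn : ψ * (ψ⁻¹ * Port.turn C Pr * ψ) * ψ⁻¹ = Port.turn C Pr := by group
    rw [hturn] at hflip
    rw [mul_inv_rev, Equiv.swap_inv, inv_inv]
    simp only [mul_assoc] at hflip ⊢
    rcases h.edge with ⟨h₁, h₂⟩ | ⟨h₁, h₂⟩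
    · rwa [h₁, h₂] at hflip
    · rw [h₁, h₂, Equiv.swap_comm (Sum.inr j')] at hflip
      simpa using hflip.opp fun x ↦ Equiv.swap_apply_self _ _ x

end IsRelabelling

end Relabellings


section Relabelled

variable {C Pr : Type u} {e e' : Out C Pr} {j' : Inp C Pr} {ψ : Equiv.Perm (Port C Pr)}
  {next next' : Out C Pr ≃ Inp C Pr}

lemma FlipFace.congr_opp {D : Type*} {f o o' f' : Equiv.Perm D} {d : D} (h : FlipFace f o d f')
    (ho : o d = o' d) : FlipFace f o' d f' := by
  obtain ⟨h₁, h₂, h₃, h₄⟩ := h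
  rw [ho] at h₁ h₂ h₃ h₄
  exact ⟨h₁, h₂, h₃, h₄⟩

namespace IsRelabelling

lemma flipFace_wire (h : IsRelabelling e (next e) e' j' ψ) :
    FlipFace (Port.turn C Pr) (Port.wire next) (.inl e) (ψ⁻¹ * Port.turn C Pr * ψ) :=
  h.flipFace.congr_opp (by simp)

lemma exists_wire (h : IsRelabelling e (next e) e' j' ψ) :
    ∃ next' : Out C Pr ≃ Inp C Pr, ∀ a, Port.wire next' (ψ a) = ψ (Port.wire next a) := by
  suffices ∀ a, (ψ.permCongr (Port.wire next) a).isRight = !a.isRight by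
    obtain ⟨next', hnext'⟩ := exists_wire_eq (fun a ↦ by simp [Port.wire_wire next _]) this
    exact ⟨next', fun a ↦ by simp [hnext']⟩
  intro a
  obtain ⟨a, rfl⟩ := ψ.surjective a
  rw [Equiv.permCongr_apply, Equiv.symm_apply_apply]
  by_cases ha₁ : a = .inl e
  · rcases h.edge with ⟨h₁, h₂⟩ | ⟨h₁, h₂⟩ <;> simp [ha₁, h₁, h₂]
  by_cases ha₂ : a = .inr (next e)
  · rcases h.edge with ⟨h₁, h₂⟩ | ⟨h₁, h₂⟩ <;> simp [ha₂, h₁, h₂]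
  rw [h.isRight_apply a ha₁ ha₂, h.isRight_apply, Port.isRight_wire]
  · rwa [Ne, (Port.wire_wire next).eq_iff, Port.wire_inl]
  · rwa [Ne, (Port.wire_wire next).eq_iff, Port.wire_inr, Equiv.symm_apply_apply]

lemma next_eq (h : IsRelabelling e (next e) e' j' ψ)
    (hwire : ∀ a, Port.wire next' (ψ a) = ψ (Port.wire next a)) : next' e' = j' := by
  have hwire_e := hwire (.inl e)
  rcases h.edge with ⟨h₁, h₂⟩ | ⟨h₁, h₂⟩ <;> rw [Port.wire_inl, h₁, h₂] at hwire_e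
  · simpa using hwire_e
  · exact (next'.symm_apply_eq.1 (by simpa using hwire_e)).symm

lemma isSphereMap (h : IsRelabelling e (next e) e' j' ψ)
    (hwire : ∀ a, Port.wire next' (ψ a) = ψ (Port.wire next a))
    (hs : IsSphereMap (Port.turn C Pr) (Port.wire next)) :
    IsSphereMap (Port.turn C Pr) (Port.wire next') := by
  have hturn (a) : ψ ((ψ⁻¹ * Port.turn C Pr * ψ) a) = Port.turn C Pr (ψ a) := by simp
  refine (h.flipFace_wire.isSphereMap Port.turn_turn_turn (Port.wire_wire next)
    (orbitCount_congr ψ hturn) hs).congr ψ hturn fun a ↦ (hwire a).symm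

lemma exists_rank (h : IsRelabelling e (next e) e' j' ψ)
    (hwire : ∀ a, Port.wire next' (ψ a) = ψ (Port.wire next a)) {p : Pr} (he : e ≠ .prod p)
    (he' : e' ≠ .prod p) (hne : e.owner ≠ (next e).owner) {rank : C ⊕ Pr → ℕ}
    (heq : rank e.owner = rank (next e).owner)
    (hlt : ∀ q, q ≠ .prod p → q ≠ e → rank q.owner < rank (next q).owner) :
    ∃ rank' : C ⊕ Pr → ℕ, ∀ q, q ≠ .prod p → rank' q.owner < rank' (next' q).owner := by
  classical
  have howner := Sym2.eq_iff.1 h.owner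
  have hne' : e'.owner ≠ j'.owner := by grind
  have heq' : rank e'.owner = rank j'.owner := by grind
  refine ⟨fun v ↦ 2 * rank v + if v = j'.owner then 1 else 0, fun q hq ↦ ?_⟩
  by_cases hqe : q = e'
  · simp [hqe, h.next_eq hwire, heq', hne']
  suffices rank q.owner < rank (next' q).owner by grind
  obtain ⟨a, ha⟩ := ψ.surjective (.inl q)
  have ha₁ : a ≠ .inl e := by rintro rfl; rcases h.edge with h | h <;> simp_all
  have ha₂ : a ≠ .inr (next e) := by rintro rfl; rcases h.edge with h | h <;> simp_all
  obtain ⟨q₀, rfl⟩ : ∃ q₀, a = .inl q₀ :=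
    Sum.isLeft_iff.1 (by simpa [ha] using (h.isRight_apply a ha₁ ha₂).symm)
  have hq₀ : q₀ ≠ .prod p := by
    rintro rfl
    rw [h.prod_apply p he.symm he'.symm] at ha
    exact hq (Sum.inl_injective ha).symm
  have hnext : ψ (.inr (next q₀)) = .inr (next' q) := by
    rw [← Port.wire_inl, ← Port.wire_inl, ← hwire, ha]
  have hq := h.owner_apply rank heq (.inl q₀)
  have hnq := h.owner_apply rank heq (.inr (next q₀))
  rw [ha] at hq
  rw [hnext] at hnq
  exact hq.trans_lt ((hlt q₀ hq₀ (by simpa using ha₁)).trans_eq hnq.symm)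

end IsRelabelling

/-- The ports of `P'` are obtained from those of `P` by `ψ`, with the same connections. -/
def PCPrograph.IsRelabelled (P P' : PCPrograph C Pr) (ψ : Equiv.Perm (Port C Pr)) : Prop :=
  P'.root = P.root ∧ ∀ a, Port.wire P'.next (ψ a) = ψ (Port.wire P.next a)

lemma PCPrograph.owner_ne {P : PCPrograph C Pr} {q : Out C Pr} (h : q ≠ .prod P.root) :
    q.owner ≠ (P.next q).owner :=
  fun heq ↦ P.acyclic q.owner (.single ⟨q, h, rfl, heq.symm⟩)

lemma PCPrograph.exists_isRelabelled {P : PCPrograph C Pr}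
    (h : IsRelabelling e (P.next e) e' j' ψ) (he : e ≠ .prod P.root) (he' : e' ≠ .prod P.root)
    (hj' : j' ≠ P.next (.prod P.root)) (hII : P.edgeType e ≠ .II) (hVI : P.edgeType e ≠ .VI) :
    ∃ P', P.IsRelabelled P' ψ := by
  have := P.finite_cop
  have := P.finite_prod
  obtain ⟨rank, heq, hlt⟩ := P.exists_rank_eq he hII hVI
  obtain ⟨next', hwire⟩ := h.exists_wire
  obtain ⟨c, hc⟩ := P.root_next
  have hroot : next' (.prod P.root) = .cop c := by
    have hcop := hwire (.inl (.prod P.root))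
    rw [h.prod_apply _ he.symm he'.symm, Port.wire_inl, Port.wire_inl, hc, h.cop_apply] at hcop
    · exact Sum.inr_injective hcop
    · exact hc ▸ P.next.injective.ne he.symm
    · exact hc ▸ hj'.symm
  obtain ⟨rank', hrank'⟩ := h.exists_rank hwire he he' (owner_ne he) heq hlt
  refine ⟨⟨next', P.root, P.finite_cop, P.finite_prod, ⟨c, hroot⟩, fun v hv ↦ ?_,
    h.isSphereMap hwire P.planar⟩, rfl, hwire⟩
  have hcycle : Relation.TransGen (· < ·) (rank' v) (rank' v) := hv.lift rank' <| by
    rintro a b ⟨q, hq, rfl, rfl⟩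
    exact hrank' q hq
  exact lt_irrefl _ (Relation.transGen_eq_self (r := ((· < ·) : ℕ → ℕ → Prop)) ▸ hcycle)

end Relabelled


section Rotations

variable {C Pr : Type u} {P P' : PCPrograph C Pr} {r : Rule} {e e' : Out C Pr}
  {ψ : Equiv.Perm (Port C Pr)} {next next' : Out C Pr ≃ Inp C Pr}

lemma formPerm_four_apply {X : Type*} [DecidableEq X] {a b c d : X} (h : [a, b, c, d].Nodup) :
    [a, b, c, d].formPerm a = b ∧ [a, b, c, d].formPerm b = c ∧ [a, b, c, d].formPerm c = d ∧
      [a, b, c, d].formPerm d = a ∧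
      ∀ x, x ≠ a → x ≠ b → x ≠ c → x ≠ d → [a, b, c, d].formPerm x = x := by
  have hx (x : X) (h₁ : x ≠ a) (h₂ : x ≠ b) (h₃ : x ≠ c) (h₄ : x ≠ d) :
      [a, b, c, d].formPerm x = x := List.formPerm_apply_of_notMem (by simp [*])
  simp only [List.nodup_cons, List.mem_cons, List.not_mem_nil] at h
  refine ⟨?_, ?_, ?_, ?_, hx⟩ <;> clear hx <;> simp [Equiv.swap_apply_def] <;> grind

lemma wire_comm_iff_out : (∀ a, Port.wire next' (ψ a) = ψ (Port.wire next a)) ↔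
    ∀ q, Port.wire next' (ψ (.inl q)) = ψ (.inr (next q)) := by
  refine ⟨fun h q ↦ h (.inl q), fun h a ↦ ?_⟩
  rcases a with q | i
  · exact h q
  · obtain ⟨q, rfl⟩ := next.surjective i
    rw [← h, Port.wire_wire, Port.wire_inr, Equiv.symm_apply_apply]

lemma wire_comm_iff_inp : (∀ a, Port.wire next' (ψ a) = ψ (Port.wire next a)) ↔
    ∀ i, Port.wire next' (ψ (.inr i)) = ψ (.inl (next.symm i)) := by
  refine ⟨fun h i ↦ h (.inr i), fun h a ↦ ?_⟩
  rcases a with q | i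
  · have hq := h (next q)
    rw [Equiv.symm_apply_apply] at hq
    rw [← hq, Port.wire_wire, Port.wire_inl]
  · exact h i

open Classical in
lemma wire_comm_formPerm_out_iff {a b c d : Out C Pr} (h : [a, b, c, d].Nodup) :
    (∀ x, Port.wire next' ([.inl a, .inl b, .inl c, .inl d].formPerm x) =
      [.inl a, .inl b, .inl c, .inl d].formPerm (Port.wire next x)) ↔
    next' b = next a ∧ next' c = next b ∧ next' d = next c ∧ next' a = next d ∧
      ∀ q, q ≠ a → q ≠ b → q ≠ c → q ≠ d → next' q = next q := by
  obtain ⟨ha, hb, hc, hd, hx⟩ := formPerm_four_apply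
    (a := .inl a) (b := .inl b) (c := .inl c) (d := (.inl d : Port C Pr)) (by simpa using h)
  have hinp (i) := hx (.inr i) (by simp) (by simp) (by simp) (by simp)
  replace hx (q) := hx (.inl q)
  rw [wire_comm_iff_out]
  generalize ([.inl a, .inl b, .inl c, .inl d] : List (Port C Pr)).formPerm = ψ at *
  simp only [hinp, ne_eq, Sum.inl.injEq] at hx ⊢
  constructor
  · intro hwire
    refine ⟨?_, ?_, ?_, ?_, fun q h₁ h₂ h₃ h₄ ↦ ?_⟩ <;> grind [Port.wire_inl]
  · rintro ⟨h₁, h₂, h₃, h₄, h₅⟩ q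
    by_cases hq : q = a ∨ q = b ∨ q = c ∨ q = d
    · rcases hq with rfl | rfl | rfl | rfl <;> simp [*]
    · grind [Port.wire_inl]

open Classical in
lemma wire_comm_formPerm_inp_iff {a b c d : Inp C Pr} (h : [a, b, c, d].Nodup) :
    (∀ x, Port.wire next' ([.inr a, .inr b, .inr c, .inr d].formPerm x) =
      [.inr a, .inr b, .inr c, .inr d].formPerm (Port.wire next x)) ↔
    next'.symm b = next.symm a ∧ next'.symm c = next.symm b ∧ next'.symm d = next.symm c ∧
      next'.symm a = next.symm d ∧
      ∀ i, i ≠ a → i ≠ b → i ≠ c → i ≠ d → next'.symm i = next.symm i := by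
  obtain ⟨ha, hb, hc, hd, hx⟩ := formPerm_four_apply
    (a := .inr a) (b := .inr b) (c := .inr c) (d := (.inr d : Port C Pr)) (by simpa using h)
  have hout (q) := hx (.inl q) (by simp) (by simp) (by simp) (by simp)
  replace hx (i) := hx (.inr i)
  rw [wire_comm_iff_inp]
  generalize ([.inr a, .inr b, .inr c, .inr d] : List (Port C Pr)).formPerm = ψ at *
  simp only [hout, ne_eq, Sum.inr.injEq] at hx ⊢
  constructor
  · intro hwire
    refine ⟨?_, ?_, ?_, ?_, fun q h₁ h₂ h₃ h₄ ↦ ?_⟩ <;> grind [Port.wire_inr]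
  · rintro ⟨h₁, h₂, h₃, h₄, h₅⟩ i
    by_cases hi : i = a ∨ i = b ∨ i = c ∨ i = d
    · rcases hi with rfl | rfl | rfl | rfl <;> simp [*]
    · grind [Port.wire_inr]

open Classical in
lemma wire_comm_formPerm_iff {q p : Out C Pr} {i j : Inp C Pr} (hqp : q ≠ p) (hi : next q = i)
    (hij : i ≠ j) (hp : next p ≠ j) :
    (∀ x, Port.wire next' ([.inr i, .inl p, .inl q, .inr j].formPerm x) =
      [.inr i, .inl p, .inl q, .inr j].formPerm (Port.wire next x)) ↔
    next' p = j ∧ next' (next.symm j) = i ∧ next' q = next p ∧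
      ∀ q', q' ≠ p → q' ≠ next.symm j → q' ≠ q → next' q' = next q' := by
  obtain ⟨h₁, h₂, h₃, h₄, h₅⟩ := formPerm_four_apply (X := Port C Pr)
    (a := .inr i) (b := .inl p) (c := .inl q) (d := .inr j) (by simp [hqp.symm, hij])
  rw [wire_comm_iff_out]
  generalize ([.inr i, .inl p, .inl q, .inr j] : List (Port C Pr)).formPerm = ψ at *
  obtain ⟨k, rfl⟩ := next.surjective j
  subst hi
  rw [next.injective.ne_iff] at hij hp
  have hout (q') (hq : q' ≠ q) (hp : q' ≠ p) : ψ (.inl q') = .inl q' :=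
    h₅ _ (by simp) (by simpa) (by simpa) (by simp)
  have hinp (q') (hq : q' ≠ q) (hk : q' ≠ k) : ψ (.inr (next q')) = .inr (next q') :=
    h₅ _ (by simpa) (by simp) (by simp) (by simpa)
  clear h₅
  simp only [Equiv.symm_apply_apply]
  constructor
  · intro hwire
    have hk := hwire k
    have hq := hwire q
    have hp := hwire p
    refine ⟨?_, ?_, ?_, fun q' hp' hk' hq' ↦ ?_⟩ <;> grind [Port.wire_inl, Port.wire_inr]
  · rintro ⟨hp', hk', hq', hx⟩ q'
    by_cases h : q' = p ∨ q' = q ∨ q' = k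
    · rcases h with rfl | rfl | rfl <;> grind [Port.wire_inl, Port.wire_inr]
    · grind [Port.wire_inl]

lemma PCPrograph.owner_next_ne {q q' : Out C Pr} (hq : q ≠ .prod P.root) (hq' : q' ≠ .prod P.root)
    (h : (P.next q).owner = q'.owner) : (P.next q').owner ≠ q.owner :=
  fun h' ↦ P.acyclic q.owner (.tail (.single ⟨q, hq, rfl, h⟩) ⟨q', hq', rfl, h'⟩)

lemma rotates_IVtoI_iff (hroot : P'.root = P.root) (he : e ≠ .prod P.root) :
    (∃ x y : C, e = .right x ∧ e' = .left x ∧ P.next (.right x) = .cop y ∧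
        P'.next (.left x) = .cop y ∧
        P'.next (.left y) = P.next (.left x) ∧
        P'.next (.right y) = P.next (.left y) ∧
        P'.next (.right x) = P.next (.right y) ∧
        ∀ q, q ≠ .left x → q ≠ .right x → q ≠ .left y → q ≠ .right y → P'.next q = P.next q) ↔
      ∃ j' ψ, Rule.IVtoI.Relabels e (P.next e) e' j' ψ ∧ P.IsRelabelled P' ψ := by
  constructor
  · rintro ⟨x, y, rfl, rfl, h₁, h₂, h₃, h₄, h₅, h₆⟩
    have hxy : x ≠ y := by simpa [h₁, Out.owner, Inp.owner] using P.owner_ne he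
    rw [h₁]
    refine ⟨_, _, .IVtoI x y hxy, hroot, ?_⟩
    rw [wire_comm_formPerm_out_iff (by simp [hxy])]
    exact ⟨h₂.trans h₁.symm, h₃, h₄, h₅, fun q hr hl hl' hr' ↦ h₆ q hl hr hl' hr'⟩
  · rintro ⟨j', ψ, h, -, hwire⟩
    generalize hj : P.next e = j at h
    cases h with | IVtoI x y hxy
    rw [wire_comm_formPerm_out_iff (by simp [hxy]), hj] at hwire
    obtain ⟨h₁, h₂, h₃, h₄, h₅⟩ := hwire
    exact ⟨x, y, rfl, rfl, hj, h₁, h₂, h₃, h₄, fun q hl hr hl' hr' ↦ h₅ q hr hl hl' hr'⟩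

lemma rotates_VIIItoIX_iff (hroot : P'.root = P.root) (he : e ≠ .prod P.root) :
    (∃ y z : Pr, e = .prod z ∧ e' = .prod z ∧ P.prev (.left y) = .prod z ∧
        P'.prev (.right y) = .prod z ∧
        P'.prev (.left y) = P.prev (.left z) ∧
        P'.prev (.left z) = P.prev (.right z) ∧
        P'.prev (.right z) = P.prev (.right y) ∧
        ∀ i, i ≠ .left y → i ≠ .right y → i ≠ .left z → i ≠ .right z → P'.prev i = P.prev i) ↔
      ∃ j' ψ, Rule.VIIItoIX.Relabels e (P.next e) e' j' ψ ∧ P.IsRelabelled P' ψ := by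
  simp only [PCPrograph.prev]
  constructor
  · rintro ⟨y, z, rfl, rfl, h₁, h₂, h₃, h₄, h₅, h₆⟩
    rw [← h₁, Equiv.apply_symm_apply]
    have hj : P.next (.prod z) = .left y := by simp [← h₁]
    have hyz : y ≠ z := by simpa [hj, Out.owner, Inp.owner, eq_comm] using P.owner_ne he
    rw [h₁]
    refine ⟨_, _, .VIIItoIX y z hyz, hroot, ?_⟩
    rw [wire_comm_formPerm_inp_iff (by simp [hyz])]
    exact ⟨h₂.trans h₁.symm, h₅, h₄, h₃, fun i hl hr hr' hl' ↦ h₆ i hl hr hl' hr'⟩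
  · rintro ⟨j', ψ, h, -, hwire⟩
    generalize hj : P.next e = j at h
    cases h with | VIIItoIX y z hyz
    have h₁ : P.next.symm (.left y) = .prod z := by rw [← hj, Equiv.symm_apply_apply]
    rw [wire_comm_formPerm_inp_iff (by simp [hyz]), h₁] at hwire
    obtain ⟨h₂, h₃, h₄, h₅, h₆⟩ := hwire
    exact ⟨y, z, rfl, rfl, h₁, h₂, h₅, h₄, h₃, fun i hl hr hl' hr' ↦ h₆ i hl hr hr' hl'⟩

lemma rotates_IIItoVII_iff (hroot : P'.root = P.root) (he : e ≠ .prod P.root)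
    (he' : e' ≠ .prod P'.root) :
    (∃ (x : C) (y : Pr), e = .left x ∧ e' = .prod y ∧ P.next (.left x) = .right y ∧
        P'.next (.prod y) = .cop x ∧
        P'.next (P.prev (.cop x)) = .right y ∧
        P'.next (.left x) = P.next (.prod y) ∧
        ∀ q, q ≠ .prod y → q ≠ P.prev (.cop x) → q ≠ .left x → P'.next q = P.next q) ↔
      ∃ j' ψ, Rule.IIItoVII.Relabels e (P.next e) e' j' ψ ∧ P.IsRelabelled P' ψ := by
  have hne {x : C} {y : Pr} (h : P.next (.left x) = .right y)
      (hy : Out.prod y ≠ (.prod P'.root : Out C Pr)) :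
      P.next (.prod y) ≠ .cop x := by
    have := P.owner_next_ne (q := .left x) (q' := .prod y) (by simp) (hroot ▸ hy)
      (by rw [h]; rfl)
    exact fun hx ↦ this (by rw [hx]; rfl)
  constructor
  · rintro ⟨x, y, rfl, rfl, h₁, h₂⟩
    rw [h₁]
    refine ⟨_, _, .IIItoVII x y, hroot, ?_⟩
    rwa [wire_comm_formPerm_iff (by simp) h₁ (by simp) (hne h₁ he')]
  · rintro ⟨j', ψ, h, -, hwire⟩
    generalize hj : P.next e = j at h
    cases h with | IIItoVII x y
    rw [wire_comm_formPerm_iff (by simp) hj (by simp) (hne hj he')] at hwire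
    exact ⟨x, y, rfl, rfl, hj, hwire⟩

lemma rotates_VIItoV_iff (hroot : P'.root = P.root) (he : e ≠ .prod P.root) :
    (∃ (x : C) (y : Pr), e = .prod y ∧ e' = .right x ∧ P.next (.prod y) = .cop x ∧
        P'.next (.right x) = .left y ∧
        P'.next (P.prev (.left y)) = .cop x ∧
        P'.next (.prod y) = P.next (.right x) ∧
        ∀ q, q ≠ .right x → q ≠ P.prev (.left y) → q ≠ .prod y → P'.next q = P.next q) ↔
      ∃ j' ψ, Rule.VIItoV.Relabels e (P.next e) e' j' ψ ∧ P.IsRelabelled P' ψ := by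
  have hne {x : C} {y : Pr} (h : P.next (.prod y) = .cop x)
      (hy : Out.prod y ≠ (.prod P.root : Out C Pr)) :
      P.next (.right x) ≠ .left y := by
    have := P.owner_next_ne (q := .prod y) (q' := .right x) hy (by simp) (by rw [h]; rfl)
    exact fun hx ↦ this (by rw [hx]; rfl)
  constructor
  · rintro ⟨x, y, rfl, rfl, h₁, h₂⟩
    rw [h₁]
    refine ⟨_, _, .VIItoV x y, hroot, ?_⟩
    rwa [wire_comm_formPerm_iff (by simp) h₁ (by simp) (hne h₁ he)]
  · rintro ⟨j', ψ, h, -, hwire⟩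
    generalize hj : P.next e = j at h
    cases h with | VIItoV x y
    rw [wire_comm_formPerm_iff (by simp) hj (by simp) (hne hj he)] at hwire
    exact ⟨x, y, rfl, rfl, hj, hwire⟩

lemma rotates_iff : Rotates r P e P' e' ↔ e ≠ .prod P.root ∧ e' ≠ .prod P'.root ∧
    ∃ j' ψ, r.Relabels e (P.next e) e' j' ψ ∧ P.IsRelabelled P' ψ := by
  by_cases hroot : P'.root = P.root
  · refine (and_iff_right hroot).trans (and_congr_right fun he ↦ and_congr_right fun he' ↦ ?_)
    cases r with
    | IVtoI => exact rotates_IVtoI_iff hroot he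
    | VIIItoIX => exact rotates_VIIItoIX_iff hroot he
    | IIItoVII => exact rotates_IIItoVII_iff hroot he he'
    | VIItoV => exact rotates_VIItoV_iff hroot he
  · exact iff_of_false (fun h ↦ hroot h.1) fun ⟨_, _, _, _, _, h⟩ ↦ hroot h.1

end Rotations


section RotationExistence

variable {C Pr : Type u} {P P' P₁ : PCPrograph C Pr} {r : Rule} {e e' e₁ : Out C Pr}
  {j j' j₁ : Inp C Pr} {ψ ψ₁ : Equiv.Perm (Port C Pr)}

namespace PCPrograph

lemma next_root_ne_cop {x : C} {y : Pr} (hx : e.owner = .inl x) (hy : (P.next e).owner = .inr y)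
    (hII : P.edgeType e ≠ .II) (hVI : P.edgeType e ≠ .VI) : P.next (.prod P.root) ≠ .cop x := by
  intro hroot
  have := P.finite_cop
  have := P.finite_prod
  obtain ⟨rank, heq, hlt⟩ := P.exists_rank_eq (by rintro rfl; simp [Out.owner] at hx) hII hVI
  have hin (w) (hw : w ≠ .inl x) : ∃ q, q ≠ .prod P.root ∧ q ≠ e ∧ (P.next q).owner = w := by
    rcases w with c | p
    · refine ⟨P.next.symm (.cop c), ?_, ?_, by simp [Inp.owner]⟩ <;>
        rw [Ne, Equiv.symm_apply_eq]
      · grind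
      · exact fun h ↦ by simp [← h, Inp.owner] at hy
    · by_cases hp : P.next e = .left p
      · refine ⟨P.next.symm (.right p), ?_, ?_, by simp [Inp.owner]⟩ <;> grind [Equiv.symm_apply_eq]
      · refine ⟨P.next.symm (.left p), ?_, ?_, by simp [Inp.owner]⟩ <;> grind [Equiv.symm_apply_eq]
  have : Nonempty (C ⊕ Pr) := ⟨.inl x⟩
  obtain ⟨w, hw⟩ := Finite.exists_min rank
  obtain rfl : w = .inl x := by
    by_contra hne
    obtain ⟨q, hq, hqe, rfl⟩ := hin w hne
    exact (hw _).not_gt (hlt q hq hqe)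
  obtain ⟨q, hq, hqe, hqy⟩ := hin (.inr y) (by simp)
  refine (hw q.owner).not_gt ?_
  rw [← hx, heq, hy, ← hqy]
  exact hlt q hq hqe

lemma root_ne {x : C} {y : Pr} (hx : e.owner = .inl x) (hy : (P.next e).owner = .inr y)
    (hII : P.edgeType e ≠ .II) (hVI : P.edgeType e ≠ .VI) : P.root ≠ y := by
  rintro rfl
  have := P.finite_cop
  have := P.finite_prod
  obtain ⟨rank, heq, hlt⟩ := P.exists_rank_eq (by rintro rfl; simp [Out.owner] at hx) hII hVI
  have hout (w) (hw : w ≠ .inr P.root) : ∃ q, q ≠ .prod P.root ∧ q ≠ e ∧ q.owner = w := by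
    rcases w with c | p
    · by_cases hc : e = .left c
      · exact ⟨.right c, by simp, by simp [hc], rfl⟩
      · exact ⟨.left c, by simp, Ne.symm hc, rfl⟩
    · exact ⟨.prod p, by simpa using hw, by rintro rfl; simp [Out.owner] at hx, rfl⟩
  have : Nonempty (C ⊕ Pr) := ⟨.inl x⟩
  obtain ⟨w, hw⟩ := Finite.exists_max rank
  obtain rfl : w = .inr P.root := by
    by_contra hne
    obtain ⟨q, hq, hqe, rfl⟩ := hout w hne
    exact (hw _).not_gt (hlt q hq hqe)
  obtain ⟨q, hq, hqe, hqx⟩ := hout (.inl x) (by simp)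
  refine (hw (P.next q).owner).not_gt ?_
  rw [← hy, ← heq, hx, ← hqx]
  exact hlt q hq hqe

lemma IsRelabelled.eq (h : P.IsRelabelled P' ψ) (h₁ : P.IsRelabelled P₁ ψ) : P' = P₁ := by
  refine PCPrograph.ext (Equiv.ext fun q ↦ ?_) (h.1.trans h₁.1.symm)
  obtain ⟨a, ha⟩ := ψ.surjective (.inl q)
  simpa [ha] using (h.2 a).trans (h₁.2 a).symm

lemma IsRelabelled.symm (h : P.IsRelabelled P' ψ) : P'.IsRelabelled P ψ⁻¹ :=
  ⟨h.1.symm, fun a ↦ by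
    rw [Equiv.Perm.eq_inv_iff_eq, ← h.2, Equiv.Perm.inv_def, Equiv.apply_symm_apply]⟩

end PCPrograph

namespace Rule.Relabels

lemma edgeType_source (h : r.Relabels e (P.next e) e' j' ψ) : P.edgeType e = r.source := by
  unfold PCPrograph.edgeType
  generalize P.next e = j at h
  cases h <;> rfl

lemma edgeType_target (h : r.Relabels e j e' (P.next e') ψ) : P.edgeType e' = r.target := by
  unfold PCPrograph.edgeType
  generalize P.next e' = j' at h
  cases h <;> rfl

lemma eq_of_source (h : r.Relabels e j e' j' ψ) (h₁ : r.Relabels e j e₁ j₁ ψ₁) :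
    e' = e₁ ∧ ψ = ψ₁ := by
  cases h <;> cases h₁ <;> exact ⟨rfl, rfl⟩

lemma eq_of_target (h : r.Relabels e j e' j' ψ) (h₁ : r.Relabels e₁ j₁ e' j' ψ₁) :
    e = e₁ ∧ ψ = ψ₁ := by
  cases h <;> cases h₁ <;> exact ⟨rfl, rfl⟩

lemma exists_of_source (he : e ≠ .prod P.root) (h : P.edgeType e = r.source) :
    ∃ e' j' ψ, r.Relabels e (P.next e) e' j' ψ := by
  have hne := P.owner_ne he
  unfold PCPrograph.edgeType at h
  generalize P.next e = j at h hne
  rcases e with x | x | x <;> rcases j with y | y | y <;> cases r <;> cases h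
  · exact ⟨_, _, _, .IIItoVII x y⟩
  · exact ⟨_, _, _, .IVtoI x y fun h ↦ hne (h ▸ rfl)⟩
  · exact ⟨_, _, _, .VIItoV y x⟩
  · exact ⟨_, _, _, .VIIItoIX y x fun h ↦ hne (h ▸ rfl)⟩

lemma exists_of_target (he : e ≠ .prod P.root) (h : P.edgeType e = r.target) :
    ∃ e₀ j₀ ψ, r.Relabels e₀ j₀ e (P.next e) ψ := by
  have hne := P.owner_ne he
  unfold PCPrograph.edgeType at h
  generalize P.next e = j at h hne
  rcases e with x | x | x <;> rcases j with y | y | y <;> cases r <;> cases h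
  · exact ⟨_, _, _, .IVtoI x y fun h ↦ hne (h ▸ rfl)⟩
  · exact ⟨_, _, _, .VIItoV x y⟩
  · exact ⟨_, _, _, .IIItoVII y x⟩
  · exact ⟨_, _, _, .VIIItoIX y x fun h ↦ hne (h ▸ rfl)⟩

lemma target_ne_root (h : r.Relabels e (P.next e) e' j' ψ) (he : e ≠ .prod P.root) :
    e' ≠ .prod P.root ∧ j' ≠ P.next (.prod P.root) := by
  obtain ⟨c, hc⟩ := P.root_next
  have htype := h.edgeType_source
  have hinj := P.next.injective.ne he
  generalize hj : P.next e = j at h hinj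
  cases h with
  | IVtoI x y => exact ⟨by simp, hinj⟩
  | VIIItoIX y z => exact ⟨he, by simp [hc]⟩
  | IIItoVII x y =>
    have hII : P.edgeType (.left x) ≠ .II := by simp [htype, Rule.source]
    have hVI : P.edgeType (.left x) ≠ .VI := by simp [htype, Rule.source]
    exact ⟨by simpa [eq_comm] using P.root_ne rfl (by rw [hj]; rfl) hII hVI,
      (P.next_root_ne_cop rfl (by rw [hj]; rfl) hII hVI).symm⟩
  | VIItoV x y => exact ⟨by simp, by simp [hc]⟩

lemma source_ne_root (h : r.Relabels e j e' (P.next e') ψ) (he' : e' ≠ .prod P.root) :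
    e ≠ .prod P.root ∧ j ≠ P.next (.prod P.root) := by
  obtain ⟨c, hc⟩ := P.root_next
  have htype := h.edgeType_target
  have hinj := P.next.injective.ne he'
  generalize hj : P.next e' = j' at h hinj
  cases h with
  | IVtoI x y => exact ⟨by simp, hinj⟩
  | VIIItoIX y z => exact ⟨he', by simp [hc]⟩
  | IIItoVII x y => exact ⟨by simp, by simp [hc]⟩
  | VIItoV x y =>
    have hII : P.edgeType (.right x) ≠ .II := by simp [htype, Rule.target]
    have hVI : P.edgeType (.right x) ≠ .VI := by simp [htype, Rule.target]
    exact ⟨by simpa [eq_comm] using P.root_ne rfl (by rw [hj]; rfl) hII hVI,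
      (P.next_root_ne_cop rfl (by rw [hj]; rfl) hII hVI).symm⟩

end Rule.Relabels

namespace Rotates

lemma edgeType_source (h : Rotates r P e P' e') : P.edgeType e = r.source := by
  obtain ⟨-, -, j', ψ, hψ, -⟩ := rotates_iff.1 h
  exact hψ.edgeType_source

lemma edgeType_target (h : Rotates r P e P' e') : P'.edgeType e' = r.target := by
  obtain ⟨-, -, j', ψ, hψ, hP⟩ := rotates_iff.1 h
  obtain rfl := hψ.isRelabelling.next_eq hP.2
  exact hψ.edgeType_target

lemma eq_of_source (h : Rotates r P e P' e') (h₁ : Rotates r P e P₁ e₁) : (P', e') = (P₁, e₁) := by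
  obtain ⟨-, -, j', ψ, hψ, hP⟩ := rotates_iff.1 h
  obtain ⟨-, -, j₁, ψ₁, hψ₁, hP₁⟩ := rotates_iff.1 h₁
  obtain ⟨rfl, rfl⟩ := hψ.eq_of_source hψ₁
  rw [hP.eq hP₁]

lemma eq_of_target (h : Rotates r P e P' e') (h₁ : Rotates r P₁ e₁ P' e') : (P, e) = (P₁, e₁) := by
  obtain ⟨-, -, j', ψ, hψ, hP⟩ := rotates_iff.1 h
  obtain ⟨-, -, j₁, ψ₁, hψ₁, hP₁⟩ := rotates_iff.1 h₁
  obtain rfl := hψ.isRelabelling.next_eq hP.2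
  obtain rfl := hψ₁.isRelabelling.next_eq hP₁.2
  obtain ⟨rfl, rfl⟩ := hψ.eq_of_target hψ₁
  rw [hP.symm.eq hP₁.symm]

end Rotates

lemma PCPrograph.exists_rotates_of_source (he : e ≠ .prod P.root) (h : P.edgeType e = r.source) :
    ∃ P' e', Rotates r P e P' e' := by
  obtain ⟨e', j', ψ, hψ⟩ := Rule.Relabels.exists_of_source he h
  obtain ⟨he', hj'⟩ := hψ.target_ne_root he
  obtain ⟨P', hP'⟩ := P.exists_isRelabelled hψ.isRelabelling he he' hj'
    (by cases r <;> simp [h, Rule.source]) (by cases r <;> simp [h, Rule.source])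
  exact ⟨P', e', rotates_iff.2 ⟨he, hP'.1 ▸ he', j', ψ, hψ, hP'⟩⟩

lemma PCPrograph.exists_rotates_of_target (he' : e' ≠ .prod P'.root)
    (h : P'.edgeType e' = r.target) : ∃ P e, Rotates r P e P' e' := by
  classical
  obtain ⟨e, j, ψ, hψ⟩ := Rule.Relabels.exists_of_target he' h
  obtain ⟨he, hj⟩ := hψ.source_ne_root he'
  have hψ' := hψ.isRelabelling.symm
  obtain ⟨P, hP⟩ := P'.exists_isRelabelled hψ' he' he hj
    (by cases r <;> simp [h, Rule.target]) (by cases r <;> simp [h, Rule.target])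
  obtain rfl := hψ'.next_eq hP.2
  have hswap (a) : Port.wire P.next (Equiv.swap (.inl e) (.inr (P.next e)) a) =
      Equiv.swap (.inl e) (.inr (P.next e)) (Port.wire P.next a) := by
    rw [← Function.Injective.swap_apply (Port.wire P.next).injective]
    simp [Equiv.swap_comm]
  refine ⟨P, e, rotates_iff.2 ⟨hP.1 ▸ he, he', _, ψ, hψ, hP.1.symm, fun a ↦ ?_⟩⟩
  rw [← Equiv.symm_apply_eq]
  simpa [hswap, eq_comm] using hP.2 (ψ a)

lemma PCPrograph.edgeType_eq_source_iff (he : e ≠ .prod P.root) : P.edgeType e = r.source ↔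
    ∃! q : PCPrograph C Pr × Out C Pr, Rotates r P e q.1 q.2 := by
  refine ⟨fun h ↦ ?_, fun ⟨q, hq, _⟩ ↦ hq.edgeType_source⟩
  obtain ⟨P', e', hP'⟩ := exists_rotates_of_source he h
  exact ⟨(P', e'), hP', fun q hq ↦ hq.eq_of_source hP'⟩

lemma PCPrograph.edgeType_eq_target_iff (he : e ≠ .prod P.root) : P.edgeType e = r.target ↔
    ∃! q : PCPrograph C Pr × Out C Pr, Rotates r q.1 q.2 P e := by
  refine ⟨fun h ↦ ?_, fun ⟨q, hq, _⟩ ↦ hq.edgeType_target⟩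
  obtain ⟨P', e', hP'⟩ := exists_rotates_of_target he h
  exact ⟨(P', e'), hP', fun q hq ↦ hq.eq_of_target hP'⟩

end RotationExistence

/-! ## Edges of types II and VI -/

section Counting

variable {C Pr : Type u}

lemma Out.card [Finite C] [Finite Pr] : Nat.card (Out C Pr) = 2 * Nat.card C + Nat.card Pr := by
  have e : Out C Pr ≃ (C ⊕ C) ⊕ Pr :=
    { toFun := fun | .left c => .inl (.inl c) | .right c => .inl (.inr c) | .prod p => .inr p
      invFun := Sum.elim (Sum.elim .left .right) .prod
      left_inv := by rintro (c | c | p) <;> rfl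
      right_inv := by rintro ((c | c) | p) <;> rfl }
  rw [Nat.card_congr e, Nat.card_sum, Nat.card_sum, two_mul]

lemma Inp.card [Finite C] [Finite Pr] : Nat.card (Inp C Pr) = Nat.card C + 2 * Nat.card Pr := by
  have e : Inp C Pr ≃ C ⊕ Pr ⊕ Pr :=
    { toFun := fun | .cop c => .inl c | .left p => .inr (.inl p) | .right p => .inr (.inr p)
      invFun := Sum.elim .cop (Sum.elim .left .right)
      left_inv := by rintro (c | p | p) <;> rfl
      right_inv := by rintro (c | p | p) <;> rfl }
  rw [Nat.card_congr e, Nat.card_sum, Nat.card_sum, two_mul]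

lemma orbitCount_turn [Finite C] [Finite Pr] :
    orbitCount (Port.turn C Pr) = Nat.card C + Nat.card Pr := by
  rw [← Nat.card_sum]
  refine Nat.card_congr (Equiv.ofBijective (Orbit.lift Port.owner Port.owner_turn) ⟨?_, ?_⟩)
  · rintro ⟨a⟩ ⟨b⟩ hab
    exact orbitOf_eq_iff.2 (Port.sameCycle_turn hab)
  · rintro (c | p)
    exacts [⟨orbitOf _ (.inr (.cop c)), rfl⟩, ⟨orbitOf _ (.inl (.prod p)), rfl⟩]

lemma orbitCount_wire (next : Out C Pr ≃ Inp C Pr) :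
    orbitCount (Port.wire next) = Nat.card (Out C Pr) := by
  refine (Nat.card_congr (Equiv.ofBijective (fun q ↦ orbitOf (Port.wire next) (.inl q))
    ⟨fun q q' h ↦ ?_, ?_⟩)).symm
  · exact eq_of_sameCycle (F := Sum.elim id next.symm) (by rintro (q | i) <;> simp)
      (orbitOf_eq_iff.1 h)
  · rintro ⟨q | i⟩
    exacts [⟨q, rfl⟩, ⟨next.symm i, orbitOf_apply (Port.wire next) (.inr i)⟩]

end Counting

lemma exists_change_of_sameCycle {D : Type u} [Finite D] {σ : Equiv.Perm D} {p : D → Prop} {a b : D}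
    (h : σ.SameCycle a b) (ha : p a) (hb : ¬ p b) : ∃ x, σ.SameCycle a x ∧ p x ∧ ¬ p (σ x) := by
  by_contra! hn
  obtain ⟨n, -, rfl⟩ := h.exists_pow_eq'
  refine hb ?_
  clear hb h
  induction n with
  | zero => exact ha
  | succ n ih =>
    rw [pow_succ', Equiv.Perm.mul_apply]
    exact hn _ ⟨n, by simp⟩ ih

lemma Triangulation.injective_of_forall_exists_eq {D : Type u} (T : Triangulation D) {A : Type*}
    [Finite A] (hA : Nat.card T.Vertex = Nat.card A + 2) (m : A → T.Vertex)
    (h : ∀ v, v ≠ T.origin T.root → v ≠ T.origin (T.opp T.root) → ∃ a, m a = v) :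
    Function.Injective m := by
  let k : Option (Option A) → T.Vertex := fun a ↦
    a.elim (T.origin T.root) fun a ↦ a.elim (T.origin (T.opp T.root)) m
  have hk : Function.Surjective k := fun v ↦ by
    by_cases h₁ : v = T.origin T.root
    · exact ⟨none, h₁.symm⟩
    by_cases h₂ : v = T.origin (T.opp T.root)
    · exact ⟨some none, h₂.symm⟩
    obtain ⟨a, ha⟩ := h v h₁ h₂
    exact ⟨some (some a), ha⟩
  have hk' := hk.bijective_of_nat_card_le (by rw [Finite.card_option, Finite.card_option, hA])
  exact fun a b hab ↦ Option.some_injective _ (Option.some_injective _ (hk'.1 hab))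

namespace PCPrograph

variable {C Pr : Type u} (P : PCPrograph C Pr)

include P in
lemma card_cop : Nat.card C = Nat.card Pr := by
  have := P.finite_cop
  have := P.finite_prod
  have h := Nat.card_congr P.next
  rw [Out.card, Inp.card] at h
  lia

lemma card_dual_vertex : Nat.card P.dual.Vertex = Nat.card Pr + 2 := by
  have := P.finite_cop
  have := P.finite_prod
  have heuler : orbitCount (Port.turn C Pr) + Nat.card P.dual.Vertex
      = orbitCount (Port.wire P.next) + 2 := P.planar.2
  rw [orbitCount_turn, orbitCount_wire, Out.card, P.card_cop] at heuler
  lia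

lemma exists_right_of_change {a : Port C Pr} (h : a.isRight = true)
    (h' : (P.facePerm a).isRight = false) : ∃ p, a = .inr (.right p) := by
  obtain ⟨b, rfl⟩ := (Port.turn C Pr).surjective a
  rw [vertexPerm_apply_face, Port.isRight_wire] at h'
  rcases b with ((c | c | p) | (c | p | p)) <;> simp_all [Port.turn]

lemma exists_left_of_change {a : Port C Pr} (h : a.isRight = false)
    (h' : (P.facePerm a).isRight = true) : ∃ c, a = .inl (.left c) := by
  obtain ⟨b, rfl⟩ := (Port.turn C Pr).surjective a
  rw [vertexPerm_apply_face, Port.isRight_wire] at h'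
  rcases b with ((c | c | p) | (c | p | p)) <;> simp_all [Port.turn]

lemma origin_right_injective :
    Function.Injective fun p : Pr ↦ P.dual.origin (.inr (.right p)) := by
  have := P.dual.finite
  have := P.finite_prod
  refine P.dual.injective_of_forall_exists_eq P.card_dual_vertex _ fun v hv hv' ↦ ?_
  obtain ⟨w, x, hx, -, hxv⟩ := P.dual.exists_adj_of_ne_source hv
  obtain ⟨w', y, hy, hyv, -⟩ := P.dual.exists_adj_of_ne_sink hv'
  obtain ⟨z, hz, hz₁, hz₂⟩ := exists_change_of_sameCycle (p := P.dual.pos)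
    (P.dual.origin_eq_iff.1 (hyv.trans hxv.symm)) hy fun h ↦ (P.dual.pos_opp x).1 h hx
  obtain ⟨p, rfl⟩ := P.exists_right_of_change hz₁ (Bool.not_eq_true _ ▸ hz₂)
  exact ⟨p, (P.dual.origin_eq_iff.2 hz).symm.trans hyv⟩

lemma origin_left_injective :
    Function.Injective fun c : C ↦ P.dual.origin (.inl (.left c)) := by
  have := P.dual.finite
  have := P.finite_cop
  refine P.dual.injective_of_forall_exists_eq (P.card_cop ▸ P.card_dual_vertex) _ fun v hv hv' ↦ ?_
  obtain ⟨w, x, hx, -, hxv⟩ := P.dual.exists_adj_of_ne_source hv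
  obtain ⟨w', y, hy, hyv, -⟩ := P.dual.exists_adj_of_ne_sink hv'
  obtain ⟨z, hz, hz₁, hz₂⟩ := exists_change_of_sameCycle (p := fun a ↦ ¬ P.dual.pos a)
    (P.dual.origin_eq_iff.1 (hxv.trans hyv.symm)) (fun h ↦ (P.dual.pos_opp x).1 h hx)
    (not_not.2 hy)
  obtain ⟨c, rfl⟩ := P.exists_left_of_change (Bool.not_eq_true _ ▸ hz₁) (not_not.1 hz₂)
  exact ⟨c, (P.dual.origin_eq_iff.2 hz).symm.trans hxv⟩

variable {P} {e : Out C Pr}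

lemma eq_of_edgeType_eq_II (h : P.edgeType e = .II) {a : Port C Pr}
    (ha : P.dual.origin a = P.dual.origin (.inl e)) (hneg : ¬ P.dual.pos a) : a = .inl e := by
  have := P.dual.finite
  obtain ⟨c, p, rfl, hnext⟩ : ∃ c p, e = .left c ∧ P.next e = .left p := by
    unfold edgeType at h
    rcases e with c | c | p <;> rcases hj : P.next _ with p | p | p <;> rw [hj] at h <;> simp_all
  by_contra hne
  obtain ⟨z, hz, hz₁, hz₂⟩ := exists_change_of_sameCycle
    (p := fun z ↦ P.dual.pos z ∨ z = .inl (.left c)) (P.dual.origin_eq_iff.1 ha.symm)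
    (.inr rfl) (not_or.2 ⟨hneg, hne⟩)
  obtain ⟨hz₂, hz₃⟩ := not_or.1 hz₂
  rcases hz₁ with hz₁ | rfl
  · obtain ⟨p', rfl⟩ := P.exists_right_of_change hz₁ (Bool.not_eq_true _ ▸ hz₂)
    have hwire : Port.wire P.next (.inr (.left p)) = .inl (.left c) := by simp [← hnext]
    obtain rfl : p' = p := P.origin_right_injective ((P.dual.origin_eq_iff.2 hz).symm.trans
      ((congrArg P.dual.origin hwire.symm).trans (P.dual.origin_opp (.inr (.left p)))))
    exact hz₃ ((vertexPerm_apply_face (D := Port C Pr) (.inr (.left p'))).trans hwire)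
  · exact hz₂ rfl

lemma eq_of_edgeType_eq_VI (h : P.edgeType e = .VI) {a : Port C Pr}
    (ha : P.dual.origin a = P.dual.origin (.inr (P.next e))) (hpos : P.dual.pos a) :
    a = .inr (P.next e) := by
  have := P.dual.finite
  obtain ⟨c, p, rfl, hnext⟩ : ∃ c p, e = .right c ∧ P.next e = .right p := by
    unfold edgeType at h
    rcases e with c | c | p <;> rcases hj : P.next _ with p | p | p <;> rw [hj] at h <;> simp_all
  by_contra hne
  obtain ⟨z, hz, hz₁, hz₂⟩ := exists_change_of_sameCycle
    (p := fun z ↦ ¬ P.dual.pos z ∨ z = .inr (P.next (.right c)))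
    (P.dual.origin_eq_iff.1 ha.symm) (.inr rfl) (not_or.2 ⟨not_not.2 hpos, hne⟩)
  obtain ⟨hz₂, hz₃⟩ := not_or.1 hz₂
  rcases hz₁ with hz₁ | rfl
  · obtain ⟨c', rfl⟩ := P.exists_left_of_change (Bool.not_eq_true _ ▸ hz₁) (not_not.1 hz₂)
    obtain rfl : c' = c := P.origin_left_injective
      ((P.dual.origin_eq_iff.2 hz).symm.trans (P.dual.origin_opp (.inl (.right c))))
    exact hz₃ (vertexPerm_apply_face (D := Port C Pr) (.inl (.right c')))
  · rw [hnext] at hz₂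
    exact hz₂ Bool.false_ne_true

end PCPrograph

namespace Triangulation.IsFlip

variable {D : Type u} {T T' : Triangulation D} {d : D}

lemma exists_origin_eq_iff (h : T.IsFlip d T') :
    ∃ v : T'.Vertex, ∀ x, T'.origin x = v ↔ T.origin x = T.origin d ∧ x ≠ d := by
  suffices hv : ∃ v : Orbit (vertexPerm T'.face T.opp), ∀ x, orbitOf _ x = v ↔
      T.origin x = T.origin d ∧ x ≠ d by
    rwa [← h.opp] at hv
  obtain ⟨k, hk, hd, hd'⟩ := h.face.exists_vertexEquiv T.face_face_face T.opp_opp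
  have hnodup := h.nodup_origin
  simp only [List.nodup_cons, List.mem_cons, List.not_mem_nil, or_false, not_or] at hnodup
  obtain ⟨⟨hne, hne₁, hne₂⟩, -⟩ := hnodup
  refine ⟨k.symm (T.origin d), fun x ↦ ?_⟩
  rw [Equiv.eq_symm_apply]
  by_cases hx : x = d
  · subst hx
    exact iff_of_false (fun h ↦ hne₂ (h.symm.trans hd)) fun h ↦ h.2 rfl
  by_cases hx' : x = T.opp d
  · subst hx'
    exact iff_of_false (fun h ↦ hne₁ (h.symm.trans hd')) fun h ↦ hne h.1.symm
  · rw [hk x hx hx']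
    exact (and_iff_left hx).symm

-- A flip of the only edge into a vertex would make this vertex a source.
lemma exists_ne_of_neg (h : T.IsFlip d T') (hd : ¬ T.pos d) :
    ∃ x ≠ d, T.origin x = T.origin d ∧ ¬ T.pos x := by
  obtain ⟨v, hv⟩ := h.exists_origin_eq_iff
  by_contra! hall
  have hpos : ∀ x, T'.origin x = v → T'.pos x := fun x hx ↦ by
    obtain ⟨hx, hne⟩ := (hv x).1 hx
    refine (h.pos_iff x hne ?_).2 (hall x hne hx)
    rintro rfl
    exact T.origin_face_ne d ((T.origin_opp d).symm.trans hx)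
  have hroot : v = T'.origin T'.root := (T'.source_iff v).1 fun x hx hxv ↦
    (T'.pos_opp x).1 (hpos _ hxv) hx
  rw [h.root] at hroot
  have hadj := T.adj_of_neg hd
  rw [← ((hv _).1 hroot.symm).1] at hadj
  exact T.not_adj_source _ hadj

lemma exists_ne_of_pos (h : T.IsFlip d T') (hd : T.pos d) :
    ∃ x ≠ d, T.origin x = T.origin d ∧ T.pos x := by
  obtain ⟨v, hv⟩ := h.exists_origin_eq_iff
  by_contra! hall
  have hneg : ∀ x, T'.origin x = v → ¬ T'.pos x := fun x hx ↦ by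
    obtain ⟨hx, hne⟩ := (hv x).1 hx
    refine fun hpos ↦ hall x hne hx ((h.pos_iff x hne ?_).1 hpos)
    rintro rfl
    exact T.origin_face_ne d ((T.origin_opp d).symm.trans hx)
  have hroot : v = T'.origin (T'.opp T'.root) := (T'.sink_iff v).1 fun x hx hxv ↦ hneg x hxv hx
  rw [h.root, h.opp] at hroot
  have hadj := T.adj_of_pos hd
  rw [← ((hv _).1 hroot.symm).1] at hadj
  exact T.not_adj_sink _ hadj

end Triangulation.IsFlip

namespace Flip

variable {C Pr D' : Type u} {P : PCPrograph C Pr} {e : Out C Pr} {T' : Triangulation D'} {d' : D'}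

lemma edgeType_ne_II (h : Flip P.dual (.inl e) T' d') : P.edgeType e ≠ .II := fun he ↦ by
  obtain ⟨T₁, h₁, -⟩ := Triangulation.flip_iff.1 h
  obtain ⟨x, hne, hx, hneg⟩ := h₁.exists_ne_of_neg Bool.false_ne_true
  exact hne (PCPrograph.eq_of_edgeType_eq_II he hx hneg)

lemma edgeType_ne_VI (h : Flip P.dual (.inl e) T' d') : P.edgeType e ≠ .VI := fun he ↦ by
  obtain ⟨T₁, h₁, -⟩ := Triangulation.flip_iff.1 h
  obtain ⟨x, hne, hx, hpos⟩ := h₁.opp_dart.exists_ne_of_pos rfl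
  exact hne (PCPrograph.eq_of_edgeType_eq_VI he hx hpos)

end Flip

/-! ## Rotations of a prograph and flips of its dual -/

section FlipsByRotations

open Triangulation

variable {C Pr : Type u} {r : Rule} {P P' P₁ : PCPrograph C Pr} {e e' e₁ : Out C Pr}

lemma PCPrograph.IsRelabelled.isFlip {j' : Inp C Pr} {ψ : Equiv.Perm (Port C Pr)}
    (h : P.IsRelabelled P' ψ) (hψ : IsRelabelling e (P.next e) e' j' ψ) (he : e ≠ .prod P.root)
    (he' : e' ≠ .prod P.root) : P.dual.IsFlip (.inl e) (P'.dual.map ψ.symm) where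
  ne_root := Sum.inl_ne_inr
  ne_opp_root := by simpa [dual] using he
  face := hψ.flipFace_wire
  opp := Equiv.ext fun a ↦ (ψ.symm_apply_eq.2 (h.2 a) :)
  root := by
    have hroot := h.2 (.inl (.prod P.root))
    rw [hψ.prod_apply _ he.symm he'.symm] at hroot
    exact ψ.symm_apply_eq.2 ((congrArg (fun p ↦ Sum.inr (P'.next (.prod p))) h.1).trans hroot)
  pos_iff a ha₁ ha₂ := iff_of_eq (congrArg (· = true) (hψ.isRight_apply a ha₁ ha₂))

namespace Rotates

lemma flip (h : Rotates r P e P' e') : Flip P.dual (.inl e) P'.dual (.inl e') := by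
  obtain ⟨he, he', j', ψ, hψ, hP⟩ := rotates_iff.1 h
  refine flip_iff.2 ⟨_, hP.isFlip hψ.isRelabelling he (hP.1 ▸ he'), ψ, by simp [map_map], ?_⟩
  rw [(hP.isFlip hψ.isRelabelling he (hP.1 ▸ he')).opp]
  rcases hψ.isRelabelling.edge with h | h
  exacts [.inl h.1.symm, .inr h.2.symm]

end Rotates

namespace RotationStep

lemma flip (h : RotationStep P e P' e') : Flip P.dual (.inl e) P'.dual (.inl e') := by
  obtain ⟨r, h | h⟩ := h
  exacts [h.flip, h.flip.symm]

lemma eq_of_edgeType_eq (h : RotationStep P e P' e') (h₁ : RotationStep P e P₁ e₁)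
    (heq : P'.edgeType e' = P₁.edgeType e₁) : (P', e') = (P₁, e₁) := by
  obtain ⟨r, h | h⟩ := h <;> obtain ⟨r₁, h₁ | h₁⟩ := h₁ <;>
    have hsource := h.edgeType_source <;> have htarget := h.edgeType_target <;>
    have hsource₁ := h₁.edgeType_source <;> have htarget₁ := h₁.edgeType_target <;>
    cases r <;> cases r₁ <;> simp only [Rule.source, Rule.target, *, reduceCtorEq] at *
  all_goals first | exact h.eq_of_source h₁ | exact h.eq_of_target h₁

end RotationStep

lemma PCPrograph.exists_rotationStep (he : e ≠ .prod P.root) (hII : P.edgeType e ≠ .II)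
    (hVI : P.edgeType e ≠ .VI) : ∃ P' e', RotationStep P e P' e' := by
  have of_source {r : Rule} (h : P.edgeType e = r.source) : ∃ P' e', RotationStep P e P' e' :=
    have ⟨P', e', h⟩ := PCPrograph.exists_rotates_of_source he h
    ⟨P', e', r, .inl h⟩
  have of_target {r : Rule} (h : P.edgeType e = r.target) : ∃ P' e', RotationStep P e P' e' :=
    have ⟨P', e', h⟩ := PCPrograph.exists_rotates_of_target he h
    ⟨P', e', r, .inr h⟩
  cases h : P.edgeType e with
  | I => exact of_target (r := .IVtoI) h
  | II => exact (hII h).elim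
  | III => exact of_source (r := .IIItoVII) h
  | IV => exact of_source (r := .IVtoI) h
  | V => exact of_target (r := .VIItoV) h
  | VI => exact (hVI h).elim
  | VII => exact of_source (r := .VIItoV) h
  | VIII => exact of_source (r := .VIIItoIX) h
  | IX => exact of_target (r := .VIIItoIX) h

lemma PCPrograph.pos_iff_or (hII : P.edgeType e ≠ .II) (hVI : P.edgeType e ≠ .VI)
    (hVII : P.edgeType e ≠ .VII) :
    (P.dual.pos (P.dual.face (P.dual.face (.inl e))) ↔
      P.dual.pos (P.dual.face (P.dual.opp (.inl e)))) ∨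
    (P.dual.pos (P.dual.face (P.dual.face (P.dual.opp (.inl e)))) ↔
      P.dual.pos (P.dual.face (.inl e))) := by
  unfold edgeType at hII hVI hVII
  rcases e with c | c | p <;> rcases hj : P.next _ with c' | p' | p' <;>
    rw [hj] at hII hVI hVII <;> simp_all [dual, Port.turn]

end FlipsByRotations

section FlipsOfDuals

open Triangulation

variable {C Pr D D' : Type u} {P P' : PCPrograph C Pr} {e e' : Out C Pr} {T : Triangulation D}
  {T' : Triangulation D'} {d' : D'}

lemma Triangulation.EdgeIsomorphic.edgeType_eq
    (h : EdgeIsomorphic P.dual (.inl e) P'.dual (.inl e')) : P.edgeType e = P'.edgeType e' := by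
  obtain ⟨κ, hκ, hd⟩ := h
  obtain ⟨hturn, hwire, hpos, -⟩ := map_eq_iff.1 hκ
  obtain ⟨f, g, hfg⟩ := Port.exists_eq_map_equiv (κ := κ) hturn fun a ↦ Bool.eq_iff_iff.2 (hpos a)
  rw [hfg] at hwire hd
  obtain rfl : e' = e.map f g := by simpa [PCPrograph.dual] using hd
  have hnext : P'.next (e.map f g) = (P.next e).map f g := by
    simpa [PCPrograph.dual] using hwire (.inl e)
  unfold PCPrograph.edgeType
  rw [hnext]
  cases e <;> cases P.next _ <;> rfl

lemma Duality.exists_dart_iff : (∃ δ' : Duality P T', d' = δ'.dart (.inl e) ∨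
    d' = T'.opp (δ'.dart (.inl e))) ↔ EdgeIsomorphic P.dual (.inl e) T' d' := by
  constructor
  · rintro ⟨δ, hd⟩
    exact ⟨δ.dart, δ.map_eq, by rwa [← δ.dart_wire] at hd⟩
  · rintro ⟨κ, hκ, hd⟩
    exact ⟨.ofMapEq hκ, by rwa [← Duality.dart_wire]⟩

lemma Duality.flip_iff (δ : Duality P T) :
    Flip T (δ.dart (.inl e)) T' d' ↔ Flip P.dual (.inl e) T' d' := by
  have h : EdgeIsomorphic P.dual (.inl e) T (δ.dart (.inl e)) :=
    Duality.exists_dart_iff.1 ⟨δ, .inl rfl⟩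
  exact ⟨fun h' ↦ (h'.symm.trans_edgeIsomorphic h.symm).symm,
    fun h' ↦ (h'.symm.trans_edgeIsomorphic h).symm⟩

lemma Flip.ne_root (h : Flip P.dual (.inl e) T' d') : e ≠ .prod P.root := by
  have ⟨_, hopp, _⟩ := h
  simpa [PCPrograph.dual] using hopp

lemma Flip.exists_rotationStep (h : Flip P.dual (.inl e) T' d') :
    ∃ P' e', RotationStep P e P' e' ∧ EdgeIsomorphic P'.dual (.inl e') T' d' := by
  by_cases hVII : P.edgeType e = .VII
  · obtain ⟨P₁, e₁, h₁⟩ := PCPrograph.exists_rotates_of_source (r := .VIItoV) h.ne_root hVII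
    obtain ⟨P₂, e₂, h₂⟩ := PCPrograph.exists_rotates_of_target (r := .IIItoVII) h.ne_root hVII
    rcases edgeIsomorphic_or h₁.flip h₂.flip.symm h with h₁₂ | h₁' | h₂'
    · have htype := h₁₂.edgeType_eq
      rw [h₁.edgeType_target, h₂.edgeType_source] at htype
      cases htype
    · exact ⟨P₁, e₁, ⟨_, .inl h₁⟩, h₁'⟩
    · exact ⟨P₂, e₂, ⟨_, .inr h₂⟩, h₂'⟩
  · obtain ⟨P₁, e₁, h₁⟩ := PCPrograph.exists_rotationStep h.ne_root h.edgeType_ne_II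
      h.edgeType_ne_VI
    exact ⟨P₁, e₁, h₁, h₁.flip.edgeIsomorphic_of_pos_iff h
      (PCPrograph.pos_iff_or h.edgeType_ne_II h.edgeType_ne_VI hVII)⟩

lemma Flip.existsUnique_rotationStep (h : Flip P.dual (.inl e) T' d') :
    ∃! q : PCPrograph C Pr × Out C Pr,
      RotationStep P e q.1 q.2 ∧ EdgeIsomorphic q.1.dual (.inl q.2) T' d' := by
  obtain ⟨P', e', hstep, hiso⟩ := h.exists_rotationStep
  exact ⟨(P', e'), ⟨hstep, hiso⟩, fun q ⟨hstep', hiso'⟩ ↦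
    hstep'.eq_of_edgeType_eq hstep (hiso'.trans hiso.symm).edgeType_eq⟩

lemma Duality.edgeType_eq_II_or_VI_iff (δ : Duality P T) (he : e ≠ .prod P.root) :
    (P.edgeType e = .II ∨ P.edgeType e = .VI) ↔
      ∀ (T' : Triangulation D) (d' : D), ¬ Flip T (δ.dart (.inl e)) T' d' := by
  constructor
  · intro h T' d' hflip
    rw [δ.flip_iff] at hflip
    exact h.elim hflip.edgeType_ne_II hflip.edgeType_ne_VI
  · contrapose!
    rintro ⟨hII, hVI⟩
    obtain ⟨P', e', hstep⟩ := PCPrograph.exists_rotationStep he hII hVI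
    exact ⟨P'.dual.map δ.dart, _, δ.flip_iff.2
      (hstep.flip.trans_edgeIsomorphic ⟨δ.dart, rfl, .inl rfl⟩)⟩

end FlipsOfDuals

theorem theorem2 :
    -- duality is a bijection, up to isomorphism, between PC prographs and rooted oriented
    -- triangulations of the sphere
    (∀ (C Pr : Type u) (P : PCPrograph C Pr),
      ∃ T : Triangulation (Port C Pr), Nonempty (Duality P T)) ∧
    (∀ (D : Type u) (T : Triangulation D),
      ∃ (C Pr : Type u) (P : PCPrograph C Pr), Nonempty (Duality P T)) ∧
    (∀ (C Pr C' Pr' D D' : Type u) (P : PCPrograph C Pr) (P' : PCPrograph C' Pr')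
      (T : Triangulation D) (T' : Triangulation D'),
      Nonempty (Duality P T) → Nonempty (Duality P' T') →
        (P.Isomorphic P' ↔ T.Isomorphic T')) ∧
    -- each rule applies at every edge of its source type other than the virtual edge, in one way,
    -- and can be reversed, in one way, at every such edge of its target type
    (∀ (C Pr : Type u) (P : PCPrograph C Pr) (e : Out C Pr) (r : Rule), e ≠ .prod P.root →
      (P.edgeType e = r.source ↔
        ∃! q : PCPrograph C Pr × Out C Pr, Rotates r P e q.1 q.2) ∧
      (P.edgeType e = r.target ↔
        ∃! q : PCPrograph C Pr × Out C Pr, Rotates r q.1 q.2 P e)) ∧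
    -- the rotations and their reverses at an edge are exactly the valid flips of the dual edge
    (∀ (C Pr D D' : Type u) (P : PCPrograph C Pr) (T : Triangulation D) (δ : Duality P T)
      (e : Out C Pr) (T' : Triangulation D') (d' : D'),
      (∀ (P' : PCPrograph C Pr) (e' : Out C Pr) (δ' : Duality P' T'),
        RotationStep P e P' e' →
        (d' = δ'.dart (.inl e') ∨ d' = T'.opp (δ'.dart (.inl e'))) →
          Flip T (δ.dart (.inl e)) T' d') ∧
      (Flip T (δ.dart (.inl e)) T' d' →
        ∃! q : PCPrograph C Pr × Out C Pr, RotationStep P e q.1 q.2 ∧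
          ∃ δ' : Duality q.1 T',
            d' = δ'.dart (.inl q.2) ∨ d' = T'.opp (δ'.dart (.inl q.2)))) ∧
    -- the edges without a valid flip are exactly those of types II and VI
    (∀ (C Pr D : Type u) (P : PCPrograph C Pr) (T : Triangulation D) (δ : Duality P T)
      (e : Out C Pr), e ≠ .prod P.root →
      ((P.edgeType e = .II ∨ P.edgeType e = .VI) ↔
        ∀ (T' : Triangulation D) (d' : D), ¬ Flip T (δ.dart (.inl e)) T' d')) := by
  refine ⟨fun C Pr P ↦ ⟨P.dual, ⟨.ofMapEq (Triangulation.map_refl _)⟩⟩,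
    fun D T ↦ exists_duality T,
    fun C Pr C' Pr' D D' P P' T T' ⟨δ⟩ ⟨δ'⟩ ↦ δ.isomorphic_iff δ',
    fun C Pr P e r he ↦
      ⟨PCPrograph.edgeType_eq_source_iff he, PCPrograph.edgeType_eq_target_iff he⟩,
    fun C Pr D D' P T δ e T' d' ↦ ⟨fun P' e' δ' hstep hd ↦ ?_, fun hflip ↦ ?_⟩,
    fun C Pr D P T δ e he ↦ δ.edgeType_eq_II_or_VI_iff he⟩
  · exact δ.flip_iff.2 (hstep.flip.trans_edgeIsomorphic (Duality.exists_dart_iff.1 ⟨δ', hd⟩))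
  · simpa only [Duality.exists_dart_iff] using (δ.flip_iff.1 hflip).existsUnique_rotationStep
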